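/- Let $a<b$ be real numbers, $q\ge1$, $n\ge0$ integers, and let $s_0,s_1,\dots$ be complex $q\times q$ matrices. **Notation.** Put $$\widehat s_k=-ab\,s_k+(a+b)s_{k+1}-s_{k+2},\qquad s^{(1)}_k=b\,s_k-s_{k+1},\qquad s^{(2)}_k=-a\,s_k+s_{k+1},$$ and let $$H_{1,j}=(s_{i+k})_{i,k=0}^j,\quad H_{2,j}=(\widehat s_{i+k})_{i,k=0}^j,\quad K_{1,j}=(s^{(1)}_{i+k})_{i,k=0}^j,\quad K_{2,j}=(s^{(2)}_{i+k})_{i,k=0}^j$$ be the corresponding block Hankel matrices (empty for $j=-1$). The sequence $(s_k)_{k=0}^{2n}$ is called Hausdorff positive definite on $[a,b]$ if $H_{1,n}$ and $H_{2,n-1}$ are positive definite; $(s_k)_{k=0}^{2n+1}$ is called Hausdorff positive definite on $[a,b]$ if $K_{1,n}$ and $K_{2,n}$ are positive definite. Let $T_j$ be the $(j+1)q\times(j+1)q$ block matrix with blocks $I_q$ on the first block subdiagonal and $0$ elsewhere, $R_j(z)=(I-zT_j)^{-1}$, and let $v_j,u_{1,j},u_{2,j},\widetilde u_{1,j},\widetilde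 u_{2,j}$ be the block columns (with $j+1$ blocks of size $q\times q$) $$v_j=\begin{pmatrix}I_q\\0\\ \vdots\\0\end{pmatrix},\quad u_{1,j}=\begin{pmatrix}0\\-s_0\\ \vdots\\-s_{j-1}\end{pmatrix},\quad u_{2,j}=\begin{pmatrix}-(a+b)s_0+s_1\\-\widehat s_0\\ \vdots\\-\widehat s_{j-1}\end{pmatrix},\quad \widetilde u_{1,j}=\begin{pmatrix}s_0\\s_1-bs_0\\ \vdots\\s_j-bs_{j-1}\end{pmatrix},\quad \widetilde u_{2,j}=\begin{pmatrix}-s_0\\-s_1+as_0\\ \vdots\\-s_j+as_{j-1}\end{pmatrix}.$$ For a sequence $t=(t_k)$ of $q\times q$ matrices let $\rho_j[t]=\bigl(-Y^*G^{-1},\,I_q\bigr)$, where $Y$ is the block column with blocks $t_j,\dots,t_{2j-1}$ and $G=(t_{i+k})_{i,k=0}^{j-1}$ (so $\rho_0[t]=I_q$). Define $$P_{1,j}(z)=\rho_j[s]R_j(z)v_j,\quad Q_{1,j}(z)=-\rho_j[s]R_j(z)u_{1,j},\quad P_{2,j}(z)=\rho_j[\widehat s]R_j(z)v_j,\quad Q_{2,j}(z)=-\rho_j[\widehat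 s]R_j(z)(u_{2,j}+z\,v_js_0),$$ $$\Gamma_{k,j}(z)=\rho_j[s^{(k)}]R_j(z)v_j,\qquad \Theta_{k,j}(z)=\rho_j[s^{(k)}]R_j(z)\widetilde u_{k,j}\qquad(k=1,2),$$ and write $F^*(w)=(F(w))^*$, $F^{*^{-1}}(w)=((F(w))^*)^{-1}$. The resolvent matrices of the truncated Hausdorff matrix moment problem are $$U^{(2n)}(z)=\begin{pmatrix}\Theta_{2,n}^*(\bar z)\Theta_{2,n}^{*^{-1}}(a)&\frac1{b-a}\Theta_{1,n}^*(\bar z)\Gamma_{1,n}^{*^{-1}}(a)\\(z-a)\Gamma_{2,n}^*(\bar z)\Theta_{2,n}^{*^{-1}}(a)&\frac{b-z}{b-a}\Gamma_{1,n}^*(\bar z)\Gamma_{1,n}^{*^{-1}}(a)\end{pmatrix},$$ $$U^{(2n+1)}(z)=\begin{pmatrix}Q_{2,n}^*(\bar z)Q_{2,n}^{*^{-1}}(a)&-Q_{1,n+1}^*(\bar z)P_{1,n+1}^{*^{-1}}(a)\\-(z-a)(b-z)P_{2,n}^*(\bar z)Q_{2,n}^{*^{-1}}(a)&P_{1,n+1}^*(\bar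 z)P_{1,n+1}^{*^{-1}}(a)\end{pmatrix}.$$ With $\lambda_j=(u_{2,j}^*+as_0v_j^*)R_j^*(a)H_{2,j}^{-1}R_j(a)(u_{2,j}+av_js_0)$ and $\tau_j=v_j^*R_j^*(a)K_{1,j}^{-1}R_j(a)v_j$, the new Dyukarev–Stieltjes parameters are $$\mathbf l_{-1}=s_0,\quad \mathbf l_0=\lambda_0,\quad \mathbf l_j=\lambda_j-\lambda_{j-1}\ (j\ge1),\qquad \mathbf m_0=\tau_0,\quad \mathbf m_j=\tau_j-\tau_{j-1}\ (j\ge1).$$ With $\mu_j=v_j^*R_j^*(a)H_{1,j}^{-1}R_j(a)v_j$ and $\nu_j=\widetilde u_{2,j}^*R_j^*(a)K_{2,j}^{-1}R_j(a)\widetilde u_{2,j}$, the older ones are $$M_0=s_0^{-1},\quad M_j=\mu_j-\mu_{j-1}\ (j\ge1),\qquad L_0=\nu_0,\quad L_j=\nu_j-\nu_{j-1}\ (j\ge1).$$ For $q\times q$ matrices $X$ and scalars $c,d$ write $$\mathcal U(X)=\begin{pmatrix}I_q&X\\0&I_q\end{pmatrix},\qquad \mathcal L(X)=\begin{pmatrix}I_q&0\\X&I_q\end{pmatrix},\qquad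 \mathcal D(c,d)=\begin{pmatrix}cI_q&0\\0&dI_q\end{pmatrix},$$ and $\overrightarrow{\prod}_{k=0}^{N}A_k=A_0A_1\cdots A_N$ (the identity for $N=-1$). **Theorem.** (i) Let $(s_k)_{k=0}^{2n}$ be Hausdorff positive definite on $[a,b]$. Then $H_{1,j}$ ($0\le j\le n$) and $H_{2,j},K_{1,j},K_{2,j}$ ($0\le j\le n-1$) are positive definite, and $\Theta_{2,n}(a)$, $\Gamma_{1,n}(a)$, $P_{1,n}(a)$ and, if $n\ge1$, $Q_{2,n-1}(a)$ are invertible, so that all objects below are well defined. Moreover: a) if $n\ge1$, then for all $z\in\mathbb C\setminus\{a,b\}$ $$U^{(2n)}(z)=\mathcal D\Bigl(\tfrac1{(b-z)(z-a)},1\Bigr)\overrightarrow{\prod_{k=0}^{n-1}}\bigl[\mathcal U((z-a)\mathbf l_{k-1})\,\mathcal L(-\mathbf m_k)\bigr]\;\mathcal U((z-a)\mathbf l_{n-1})\;\mathcal L\Bigl(Q_{2,n-1}^{-1}(a)P_{2,n-1}(a)+\tfrac1{b-a}\Theta_{2,n}^{-1}(a)\Gamma_{2,n}(a)\Bigr)\;\mathcal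 D\Bigl((b-a)(z-a),\tfrac{b-z}{b-a}\Bigr);$$ b) for all $z\in\mathbb C$ $$U^{(2n)}(z)=\overrightarrow{\prod_{k=0}^{n-1}}\bigl[\mathcal L(-(z-a)M_k)\,\mathcal U(L_k)\bigr]\;\mathcal L(-(z-a)M_n)\;\mathcal U\Bigl(Q_{1,n}^*(a)P_{1,n}^{*^{-1}}(a)+\tfrac1{b-a}\Theta_{1,n}^*(a)\Gamma_{1,n}^{*^{-1}}(a)\Bigr).$$ (ii) Let $(s_k)_{k=0}^{2n+1}$ be Hausdorff positive definite on $[a,b]$. Then $H_{1,j},K_{1,j},K_{2,j}$ ($0\le j\le n$) and $H_{2,j}$ ($0\le j\le n-1$) are positive definite, and $Q_{2,n}(a)$, $P_{1,n+1}(a)$, $\Gamma_{1,n}(a)$, $\Theta_{2,n}(a)$ are invertible. Moreover: a) for all $z\in\mathbb C\setminus\{b\}$ $$U^{(2n+1)}(z)=\mathcal D\Bigl(\tfrac1{b-z},1\Bigr)\overrightarrow{\prod_{k=0}^{n}}\bigl[\mathcal U(\mathbf l_{k-1})\,\mathcal L(-(z-a)\mathbf m_k)\bigr]\;\mathcal U\Bigl(-\Gamma_{1,n}^{-1}(a)\Theta_{1,n}(a)-(b-a)P_{1,n+1}^{-1}(a)Q_{1,n+1}(a)\Bigr)\;\mathcal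 D(b-z,1);$$ b) for all $z\in\mathbb C\setminus\{a\}$ $$U^{(2n+1)}(z)=\mathcal D\Bigl(\tfrac1{z-a},1\Bigr)\overrightarrow{\prod_{k=0}^{n}}\bigl[\mathcal L(-M_k)\,\mathcal U((z-a)L_k)\bigr]\;\mathcal L\Bigl(-\Gamma_{2,n}^*(a)\Theta_{2,n}^{*^{-1}}(a)-(b-a)P_{2,n}^*(a)Q_{2,n}^{*^{-1}}(a)\Bigr)\;\mathcal D(z-a,1).$$ -/

import Mathlib

open scoped Matrix ComplexOrder

noncomputable section

namespace THMM

variable {q : ℕ}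

/-- The block matrix with `M × N` blocks of size `q × q`, the `(i, k)` block being `f i k`. -/
def blockMat (M N : ℕ) (f : ℕ → ℕ → Matrix (Fin q) (Fin q) ℂ) :
    Matrix (Fin M × Fin q) (Fin N × Fin q) ℂ :=
  Matrix.of fun x y => f x.1 y.1 x.2 y.2

/-- The block column with `N` blocks of size `q × q`, the `i`-th block being `f i`. -/
def blockCol (N : ℕ) (f : ℕ → Matrix (Fin q) (Fin q) ℂ) :
    Matrix (Fin N × Fin q) (Fin q) ℂ :=
  Matrix.of fun x y => f x.1 x.2 y

/-- The block Hankel matrix `{t_{i+k}}` with `N × N` blocks (the empty matrix for `N = 0`). -/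
def hankel (t : ℕ → Matrix (Fin q) (Fin q) ℂ) (N : ℕ) :
    Matrix (Fin N × Fin q) (Fin N × Fin q) ℂ :=
  blockMat N N fun i k => t (i + k)

/-- `ŝ_k = -a b s_k + (a + b) s_{k+1} - s_{k+2}`. -/
def hatSeq (a b : ℝ) (s : ℕ → Matrix (Fin q) (Fin q) ℂ) (k : ℕ) : Matrix (Fin q) (Fin q) ℂ :=
  -((a * b : ℂ) • s k) + (a + b : ℂ) • s (k + 1) - s (k + 2)

/-- `b s_k - s_{k+1}`. -/
def rightSeq (b : ℝ) (s : ℕ → Matrix (Fin q) (Fin q) ℂ) (k : ℕ) : Matrix (Fin q) (Fin q) ℂ :=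
  (b : ℂ) • s k - s (k + 1)

/-- `-a s_k + s_{k+1}`. -/
def leftSeq (a : ℝ) (s : ℕ → Matrix (Fin q) (Fin q) ℂ) (k : ℕ) : Matrix (Fin q) (Fin q) ℂ :=
  -((a : ℂ) • s k) + s (k + 1)

/-- `H_{1,N-1}`; the argument `N` is the number of block rows, here and in the next three
definitions. -/
def H1 (s : ℕ → Matrix (Fin q) (Fin q) ℂ) (N : ℕ) :
    Matrix (Fin N × Fin q) (Fin N × Fin q) ℂ :=
  hankel s N

/-- `H_{2,N-1}`. -/
def H2 (a b : ℝ) (s : ℕ → Matrix (Fin q) (Fin q) ℂ) (N : ℕ) :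
    Matrix (Fin N × Fin q) (Fin N × Fin q) ℂ :=
  hankel (hatSeq a b s) N

/-- `K_{1,N-1}`. -/
def K1 (b : ℝ) (s : ℕ → Matrix (Fin q) (Fin q) ℂ) (N : ℕ) :
    Matrix (Fin N × Fin q) (Fin N × Fin q) ℂ :=
  hankel (rightSeq b s) N

/-- `K_{2,N-1}`. -/
def K2 (a : ℝ) (s : ℕ → Matrix (Fin q) (Fin q) ℂ) (N : ℕ) :
    Matrix (Fin N × Fin q) (Fin N × Fin q) ℂ :=
  hankel (leftSeq a s) N

/-- `(s_k)_{k=0}^{2n}` is a Hausdorff positive definite sequence on `[a, b]`: `H_{1,n}` and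
`H_{2,n-1}` are positive definite. The terms `s_k` with `k > 2n` do not enter. -/
def HausdorffPosDefEven (a b : ℝ) (s : ℕ → Matrix (Fin q) (Fin q) ℂ) (n : ℕ) : Prop :=
  (H1 s (n + 1)).PosDef ∧ (H2 a b s n).PosDef

/-- `(s_k)_{k=0}^{2n+1}` is a Hausdorff positive definite sequence on `[a, b]`: `K_{1,n}` and
`K_{2,n}` are positive definite. The terms `s_k` with `k > 2n+1` do not enter. -/
def HausdorffPosDefOdd (a b : ℝ) (s : ℕ → Matrix (Fin q) (Fin q) ℂ) (n : ℕ) : Prop :=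
  (K1 b s (n + 1)).PosDef ∧ (K2 a s (n + 1)).PosDef

/-- The block shift `T_j`, with identity blocks on the first block subdiagonal. -/
def shiftT (q j : ℕ) : Matrix (Fin (j + 1) × Fin q) (Fin (j + 1) × Fin q) ℂ :=
  blockMat (j + 1) (j + 1) fun i k => if i = k + 1 then 1 else 0

/-- `R_j(z) = (I - z T_j)⁻¹`. -/
def resolvR (q j : ℕ) (z : ℂ) : Matrix (Fin (j + 1) × Fin q) (Fin (j + 1) × Fin q) ℂ :=
  (1 - z • shiftT q j)⁻¹

/-- `v_j = (I_q, 0, …, 0)ᵀ`, with `j + 1` blocks. -/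
def colV (q j : ℕ) : Matrix (Fin (j + 1) × Fin q) (Fin q) ℂ :=
  blockCol (j + 1) fun i => if i = 0 then 1 else 0

/-- `u_{1,j} = (0, -s_0, …, -s_{j-1})ᵀ`. -/
def colU1 (s : ℕ → Matrix (Fin q) (Fin q) ℂ) (j : ℕ) : Matrix (Fin (j + 1) × Fin q) (Fin q) ℂ :=
  blockCol (j + 1) fun i => match i with
    | 0 => 0
    | i + 1 => -s i

/-- `u_{2,j} = (-(a + b) s_0 + s_1, -ŝ_0, …, -ŝ_{j-1})ᵀ`. -/
def colU2 (a b : ℝ) (s : ℕ → Matrix (Fin q) (Fin q) ℂ) (j : ℕ) :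
    Matrix (Fin (j + 1) × Fin q) (Fin q) ℂ :=
  blockCol (j + 1) fun i => match i with
    | 0 => -((a + b : ℂ) • s 0) + s 1
    | i + 1 => -hatSeq a b s i

/-- `ũ_{1,j} = (s_0, s_1 - b s_0, …, s_j - b s_{j-1})ᵀ`. -/
def colUt1 (b : ℝ) (s : ℕ → Matrix (Fin q) (Fin q) ℂ) (j : ℕ) :
    Matrix (Fin (j + 1) × Fin q) (Fin q) ℂ :=
  blockCol (j + 1) fun i => match i with
    | 0 => s 0
    | i + 1 => s (i + 1) - (b : ℂ) • s i

/-- `ũ_{2,j} = (-s_0, -s_1 + a s_0, …, -s_j + a s_{j-1})ᵀ`. -/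
def colUt2 (a : ℝ) (s : ℕ → Matrix (Fin q) (Fin q) ℂ) (j : ℕ) :
    Matrix (Fin (j + 1) × Fin q) (Fin q) ℂ :=
  blockCol (j + 1) fun i => match i with
    | 0 => -s 0
    | i + 1 => -s (i + 1) + (a : ℂ) • s i

/-- The block row `(-Y* G⁻¹, I_q)` with `j + 1` blocks, where `G` is the block Hankel matrix of `t`
with `j × j` blocks and `Y = (t_j, …, t_{2j-1})ᵀ`. For `j = 0` it is `I_q`. -/
def monicRow (t : ℕ → Matrix (Fin q) (Fin q) ℂ) (j : ℕ) :
    Matrix (Fin q) (Fin (j + 1) × Fin q) ℂ :=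
  Matrix.of fun x y =>
    Fin.lastCases (motive := fun _ => ℂ)
      ((1 : Matrix (Fin q) (Fin q) ℂ) x y.2)
      (fun i => (-((blockCol j fun k => t (j + k))ᴴ * (hankel t j)⁻¹)) x (i, y.2))
      y.1

/-- `P_{1,j}(z)`. For `j = 0` this is `I_q`. -/
def P1 (s : ℕ → Matrix (Fin q) (Fin q) ℂ) (j : ℕ) (z : ℂ) : Matrix (Fin q) (Fin q) ℂ :=
  monicRow s j * resolvR q j z * colV q j

/-- `P_{2,j}(z, a, b)`. For `j = 0` this is `I_q`. -/
def P2 (a b : ℝ) (s : ℕ → Matrix (Fin q) (Fin q) ℂ) (j : ℕ) (z : ℂ) : Matrix (Fin q) (Fin q) ℂ :=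
  monicRow (hatSeq a b s) j * resolvR q j z * colV q j

/-- `Q_{1,j}(z)`. For `j = 0` this is `0`. -/
def Q1 (s : ℕ → Matrix (Fin q) (Fin q) ℂ) (j : ℕ) (z : ℂ) : Matrix (Fin q) (Fin q) ℂ :=
  -(monicRow s j * resolvR q j z * colU1 s j)

/-- `Q_{2,j}(z, a, b)`. For `j = 0` this is `-(u_{2,0} + z s_0)`. -/
def Q2 (a b : ℝ) (s : ℕ → Matrix (Fin q) (Fin q) ℂ) (j : ℕ) (z : ℂ) : Matrix (Fin q) (Fin q) ℂ :=
  -(monicRow (hatSeq a b s) j * resolvR q j z * (colU2 a b s j + z • (colV q j * s 0)))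

/-- `Γ_{1,j}(z, b)`. For `j = 0` this is `I_q`. -/
def Gamma1 (b : ℝ) (s : ℕ → Matrix (Fin q) (Fin q) ℂ) (j : ℕ) (z : ℂ) :
    Matrix (Fin q) (Fin q) ℂ :=
  monicRow (rightSeq b s) j * resolvR q j z * colV q j

/-- `Γ_{2,j}(z, a)`. For `j = 0` this is `I_q`. -/
def Gamma2 (a : ℝ) (s : ℕ → Matrix (Fin q) (Fin q) ℂ) (j : ℕ) (z : ℂ) :
    Matrix (Fin q) (Fin q) ℂ :=
  monicRow (leftSeq a s) j * resolvR q j z * colV q j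

/-- `Θ_{1,j}(z, b)`. For `j = 0` this is `s_0`. -/
def Theta1 (b : ℝ) (s : ℕ → Matrix (Fin q) (Fin q) ℂ) (j : ℕ) (z : ℂ) :
    Matrix (Fin q) (Fin q) ℂ :=
  monicRow (rightSeq b s) j * resolvR q j z * colUt1 b s j

/-- `Θ_{2,j}(z, a)`. For `j = 0` this is `-s_0`. -/
def Theta2 (a : ℝ) (s : ℕ → Matrix (Fin q) (Fin q) ℂ) (j : ℕ) (z : ℂ) :
    Matrix (Fin q) (Fin q) ℂ :=
  monicRow (leftSeq a s) j * resolvR q j z * colUt2 a s j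

/-- `F*(z̄)`, that is, the adjoint of the value of `F` at the conjugate of `z`. -/
def starConj (F : ℂ → Matrix (Fin q) (Fin q) ℂ) (z : ℂ) : Matrix (Fin q) (Fin q) ℂ :=
  (F (starRingEnd ℂ z))ᴴ

/-- The resolvent matrix `U^{(2j)}(z, a, b)`. -/
def resolventEven (a b : ℝ) (s : ℕ → Matrix (Fin q) (Fin q) ℂ) (j : ℕ) (z : ℂ) :
    Matrix (Fin q ⊕ Fin q) (Fin q ⊕ Fin q) ℂ :=
  Matrix.fromBlocks
    (starConj (Theta2 a s j) z * ((Theta2 a s j a)ᴴ)⁻¹)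
    ((1 / (b - a) : ℂ) • (starConj (Theta1 b s j) z * ((Gamma1 b s j a)ᴴ)⁻¹))
    ((z - a) • (starConj (Gamma2 a s j) z * ((Theta2 a s j a)ᴴ)⁻¹))
    (((b - z) / (b - a) : ℂ) • (starConj (Gamma1 b s j) z * ((Gamma1 b s j a)ᴴ)⁻¹))

/-- The resolvent matrix `U^{(2j+1)}(z, a, b)`. -/
def resolventOdd (a b : ℝ) (s : ℕ → Matrix (Fin q) (Fin q) ℂ) (j : ℕ) (z : ℂ) :
    Matrix (Fin q ⊕ Fin q) (Fin q ⊕ Fin q) ℂ :=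
  Matrix.fromBlocks
    (starConj (Q2 a b s j) z * ((Q2 a b s j a)ᴴ)⁻¹)
    (-(starConj (Q1 s (j + 1)) z * ((P1 s (j + 1) a)ᴴ)⁻¹))
    (-(((z - a) * (b - z)) • (starConj (P2 a b s j) z * ((Q2 a b s j a)ᴴ)⁻¹)))
    (starConj (P1 s (j + 1)) z * ((P1 s (j + 1) a)ᴴ)⁻¹)

/-- `w* R_j(a)* G⁻¹ R_j(a) w`. -/
def quadAt (a : ℝ) (j : ℕ) (G : Matrix (Fin (j + 1) × Fin q) (Fin (j + 1) × Fin q) ℂ)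
    (w : Matrix (Fin (j + 1) × Fin q) (Fin q) ℂ) : Matrix (Fin q) (Fin q) ℂ :=
  wᴴ * (resolvR q j a)ᴴ * G⁻¹ * resolvR q j a * w

/-- `(u_{2,j}* + a s_0 v_j*) R_j(a)* H_{2,j}⁻¹ R_j(a) (u_{2,j} + a v_j s_0)`; the left factor is the
adjoint of the right one because `s_0` is Hermitian for the sequences considered. -/
def lSum (a b : ℝ) (s : ℕ → Matrix (Fin q) (Fin q) ℂ) (j : ℕ) : Matrix (Fin q) (Fin q) ℂ :=
  ((colU2 a b s j)ᴴ + (a : ℂ) • (s 0 * (colV q j)ᴴ)) * (resolvR q j a)ᴴ * (H2 a b s (j + 1))⁻¹ *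
    resolvR q j a * (colU2 a b s j + (a : ℂ) • (colV q j * s 0))

/-- The parameters `𝐥_{-1}, 𝐥_0, 𝐥_1, …` with the index shifted by one: `lPar a b s k` is
`𝐥_{k-1}(a, b)`. -/
def lPar (a b : ℝ) (s : ℕ → Matrix (Fin q) (Fin q) ℂ) : ℕ → Matrix (Fin q) (Fin q) ℂ
  | 0 => s 0
  | 1 => lSum a b s 0
  | k + 2 => lSum a b s (k + 1) - lSum a b s k

/-- The parameters `𝐦_k(a, b)`. -/
def mPar (a b : ℝ) (s : ℕ → Matrix (Fin q) (Fin q) ℂ) : ℕ → Matrix (Fin q) (Fin q) ℂ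
  | 0 => quadAt a 0 (K1 b s 1) (colV q 0)
  | k + 1 => quadAt a (k + 1) (K1 b s (k + 2)) (colV q (k + 1)) -
      quadAt a k (K1 b s (k + 1)) (colV q k)

/-- The parameters `M_k(a)`. -/
def bigMPar (a : ℝ) (s : ℕ → Matrix (Fin q) (Fin q) ℂ) : ℕ → Matrix (Fin q) (Fin q) ℂ
  | 0 => (s 0)⁻¹
  | k + 1 => quadAt a (k + 1) (H1 s (k + 2)) (colV q (k + 1)) -
      quadAt a k (H1 s (k + 1)) (colV q k)

/-- The parameters `L_k(a)`. -/
def bigLPar (a : ℝ) (s : ℕ → Matrix (Fin q) (Fin q) ℂ) : ℕ → Matrix (Fin q) (Fin q) ℂ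
  | 0 => (colUt2 a s 0)ᴴ * (K2 a s 1)⁻¹ * colUt2 a s 0
  | k + 1 => quadAt a (k + 1) (K2 a s (k + 2)) (colUt2 a s (k + 1)) -
      quadAt a k (K2 a s (k + 1)) (colUt2 a s k)

/-- `[[I, X], [0, I]]`. -/
def upper (X : Matrix (Fin q) (Fin q) ℂ) : Matrix (Fin q ⊕ Fin q) (Fin q ⊕ Fin q) ℂ :=
  Matrix.fromBlocks 1 X 0 1

/-- `[[I, 0], [X, I]]`. -/
def lower (X : Matrix (Fin q) (Fin q) ℂ) : Matrix (Fin q ⊕ Fin q) (Fin q ⊕ Fin q) ℂ :=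
  Matrix.fromBlocks 1 0 X 1

/-- `[[c I, 0], [0, d I]]`. -/
def scalDiag (q : ℕ) (c d : ℂ) : Matrix (Fin q ⊕ Fin q) (Fin q ⊕ Fin q) ℂ :=
  Matrix.fromBlocks (c • 1) 0 0 (d • 1)

/-- The ordered product `A_0 A_1 ⋯ A_{N-1}`. -/
def rightProd (N : ℕ) (A : ℕ → Matrix (Fin q ⊕ Fin q) (Fin q ⊕ Fin q) ℂ) :
    Matrix (Fin q ⊕ Fin q) (Fin q ⊕ Fin q) ℂ :=
  ((List.range N).map A).prod

end THMM

end

open THMM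

/-! Block rows are read as matrix polynomials with coefficients on the left, and block columns as
left-linear functionals: R_j(z)v_j is evaluation at z, while the u-columns give divided differences,
F ↦ ∫ (F(x) - F(z))/(x - z) dσ(x), written E_z below. Thus P, Q, Γ, Θ are values of such functionals
at monic orthogonal polynomials for the weights 1, b - x, x - a and (x - a)(b - x); here dσ stands
only for the formal functional with moments s_k.

For moments t, two normalized polynomials carry the argument. The kernel K_N (`kernelPoly`)
reproduces values at a in degree < N; hence it is orthogonal for the weight x - a. The polynomial
U_N = 1 - (x - a)M_N (`unitPoly`) is orthogonal for t and has value 1 at a, where M_N (`markovPoly`)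
represents dt against (x - a)dt. Orthogonal polynomials of degree at most N form a rank-one left
module (`IsOrth.eq_apply_smul`), so K_{N+1} - K_N is a left multiple of U_N, and M_{N+1} - M_N is
one of K_{N+1}. The coefficients are the increments of K_N(a) and of ∫ M_N dt, which are exactly the
Dyukarev–Stieltjes parameters: M_k, L_k for t = s, and m_k, l_k for t = s^{(1)}. In matrix form each
recurrence is multiplication of `pairMat` by one triangular factor, which yields
`rightProd_eq_pairMat`.

The resolvent matrices are also of the form `pairMat a s F G`, but the polynomial coming from the
endpoint b is not the one in the Stieltjes chain. The same rank-one principle shows that it differs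
from it by a single elementary step (`mulSub_unitPoly_eq`, `kernelPoly_eq_of_even`,
`unitPoly_succ_eq`, `neg_mulSub_kernelPoly_eq`); this step is the last triangular factor. The factor
U(s_0) and diagonal scalings pass between s^{(1)} and s. -/

noncomputable section

namespace THMM

open Polynomial

variable {q : ℕ}

/-! ### Left-linear functionals on matrix polynomials -/

/-- Polynomials with `q × q` matrix coefficients. -/
abbrev MatPoly (q : ℕ) := (Matrix (Fin q) (Fin q) ℂ)[X]

/-- The value `∑ F_i w_i` of the left linear functional with moments `w_i` at the matrix
polynomial `F = ∑ F_i X^i`. -/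
def momentPair (w : ℕ → Matrix (Fin q) (Fin q) ℂ) :
    MatPoly q →ₗ[Matrix (Fin q) (Fin q) ℂ] Matrix (Fin q) (Fin q) ℂ :=
  Polynomial.lsum fun i => LinearMap.toSpanSingleton _ _ (w i)

/-- The powers of a scalar, as matrices: the moments of the evaluation at `z`. -/
def powSeq (q : ℕ) (z : ℂ) (i : ℕ) : Matrix (Fin q) (Fin q) ℂ := z ^ i • 1

/-- `∑_{k < i} z^{i-1-k} s_k`: the moments of the divided difference functional
`F ↦ ∫ (F(x) - F(z)) / (x - z) dσ(x)`. -/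
def divDiffSeq (s : ℕ → Matrix (Fin q) (Fin q) ℂ) (z : ℂ) : ℕ → Matrix (Fin q) (Fin q) ℂ
  | 0 => 0
  | i + 1 => z • divDiffSeq s z i + s i

/-- Multiplication of a matrix polynomial by `X - c`. -/
def mulSub (c : ℂ) : MatPoly q →ₗ[Matrix (Fin q) (Fin q) ℂ]
    MatPoly q where
  toFun F := F * X - c • F
  map_add' F G := by rw [add_mul, smul_add]; abel
  map_smul' r F := by
    rw [RingHom.id_apply, smul_sub, smul_mul_assoc, smul_comm]

theorem mulSub_apply (c : ℂ) (F : MatPoly q) :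
    mulSub c F = F * X - c • F := rfl

theorem mulSub_comm (c d : ℂ) (F : MatPoly q) :
    mulSub c (mulSub d F) = mulSub d (mulSub c F) := by
  simp only [mulSub_apply, sub_mul, smul_sub, smul_mul_assoc, smul_comm d c]
  abel

theorem mulSub_eq_add (c d : ℂ) (F : MatPoly q) :
    mulSub c F = mulSub d F + (d - c) • F := by
  simp only [mulSub_apply, sub_smul]
  abel

theorem mulSub_mem_degreeLT (c : ℂ) {F : MatPoly q} {N : ℕ}
    (hF : F ∈ degreeLT (Matrix (Fin q) (Fin q) ℂ) N) :
    mulSub c F ∈ degreeLT (Matrix (Fin q) (Fin q) ℂ) (N + 1) := by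
  rw [mem_degreeLT, degree_lt_iff_coeff_zero] at *
  rintro (_ | m) hm
  · omega
  · simp [mulSub_apply, hF m (by omega), hF (m + 1) (by omega)]

theorem momentPair_monomial (w : ℕ → Matrix (Fin q) (Fin q) ℂ) (i : ℕ)
    (r : Matrix (Fin q) (Fin q) ℂ) : momentPair w (monomial i r) = r * w i := by
  simp [momentPair, lsum, sum_monomial_index]

theorem momentPair_one (w : ℕ → Matrix (Fin q) (Fin q) ℂ) : momentPair w 1 = w 0 := by
  rw [← monomial_zero_one, momentPair_monomial, one_mul]

theorem momentPair_csmul (w : ℕ → Matrix (Fin q) (Fin q) ℂ) (c : ℂ)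
    (F : MatPoly q) : momentPair w (c • F) = c • momentPair w F :=
  LinearMap.map_smul_of_tower _ _ _

theorem mulSub_csmul (d c : ℂ) (F : MatPoly q) :
    mulSub d (c • F) = c • mulSub d F :=
  LinearMap.map_smul_of_tower _ _ _

theorem momentPair_mulSub (w : ℕ → Matrix (Fin q) (Fin q) ℂ) (c : ℂ)
    (F : MatPoly q) :
    momentPair w (mulSub c F) = momentPair (fun i => w (i + 1) - c • w i) F := by
  induction F using Polynomial.induction_on' with
  | add F G hF hG => rw [map_add, map_add, map_add, hF, hG]
  | monomial i r =>
    rw [mulSub_apply, monomial_mul_X, smul_monomial, map_sub]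
    simp only [momentPair_monomial, mul_sub, smul_mul_assoc, mul_smul_comm]

theorem momentPair_add_seq (w u : ℕ → Matrix (Fin q) (Fin q) ℂ)
    (F : MatPoly q) :
    momentPair (fun i => w i + u i) F = momentPair w F + momentPair u F := by
  induction F using Polynomial.induction_on' with
  | add F G hF hG => rw [map_add, map_add, map_add, hF, hG]; abel
  | monomial i r => simp only [momentPair_monomial, mul_add]

theorem momentPair_smul_seq (w : ℕ → Matrix (Fin q) (Fin q) ℂ) (c : ℂ)
    (F : MatPoly q) :
    momentPair (fun i => c • w i) F = c • momentPair w F := by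
  induction F using Polynomial.induction_on' with
  | add F G hF hG => rw [map_add, map_add, hF, hG, smul_add]
  | monomial i r => simp only [momentPair_monomial, mul_smul_comm]

theorem momentPair_neg_seq (w : ℕ → Matrix (Fin q) (Fin q) ℂ)
    (F : MatPoly q) :
    momentPair (fun i => -w i) F = -momentPair w F := by
  simpa using momentPair_smul_seq w (-1) F

theorem momentPair_mul_const (w : ℕ → Matrix (Fin q) (Fin q) ℂ) (A : Matrix (Fin q) (Fin q) ℂ)
    (F : MatPoly q) :
    momentPair (fun i => w i * A) F = momentPair w F * A := by
  induction F using Polynomial.induction_on' with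
  | add F G hF hG => rw [map_add, map_add, hF, hG, add_mul]
  | monomial i r => simp only [momentPair_monomial, mul_assoc]

theorem momentPair_powSeq_mulSub (z c : ℂ) (F : MatPoly q) :
    momentPair (powSeq q z) (mulSub c F) = (z - c) • momentPair (powSeq q z) F := by
  rw [momentPair_mulSub, ← momentPair_smul_seq]
  congr 2
  funext i
  rw [powSeq, powSeq, pow_succ', mul_smul, sub_smul]

/-- Divide (x - c)F(x) - (z - c)F(z) = (z - c)(F(x) - F(z)) + (x - z)F(x) by x - z and integrate. At
z = c only the integral of F survives, which is how integrals turn into divided differences later.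
-/
theorem momentPair_divDiffSeq_mulSub (s : ℕ → Matrix (Fin q) (Fin q) ℂ) (z c : ℂ)
    (F : MatPoly q) :
    momentPair (divDiffSeq s z) (mulSub c F) =
      (z - c) • momentPair (divDiffSeq s z) F + momentPair s F := by
  rw [momentPair_mulSub, ← momentPair_smul_seq, ← momentPair_add_seq]
  congr 2
  funext i
  rw [divDiffSeq, sub_smul]
  abel

theorem momentPair_leftSeq (a : ℝ) (s : ℕ → Matrix (Fin q) (Fin q) ℂ) (k : ℕ)
    (F : MatPoly q) :
    momentPair (fun i => leftSeq a s (i + k)) F =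
      momentPair (fun i => s (i + k)) (mulSub a F) := by
  rw [momentPair_mulSub]
  congr 2
  funext i
  rw [leftSeq, add_right_comm]
  abel

theorem momentPair_rightSeq (b : ℝ) (s : ℕ → Matrix (Fin q) (Fin q) ℂ) (k : ℕ)
    (F : MatPoly q) :
    momentPair (fun i => rightSeq b s (i + k)) F =
      -momentPair (fun i => s (i + k)) (mulSub b F) := by
  rw [momentPair_mulSub, ← momentPair_neg_seq]
  congr 2
  funext i
  rw [rightSeq, add_right_comm]
  abel

/-- This integrates, for F = X^i, the identity (b - x)(F(x) - F(z)) = -((x - b)F(x) - (z - b)F(z)) +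
(x - z)F(z) after division by x - z. -/
theorem divDiffSeq_rightSeq (b : ℝ) (s : ℕ → Matrix (Fin q) (Fin q) ℂ) (z : ℂ) (i : ℕ) :
    divDiffSeq (rightSeq b s) z i =
      -(divDiffSeq s z (i + 1) - (b : ℂ) • divDiffSeq s z i) + powSeq q z i * s 0 := by
  induction i with
  | zero => simp [divDiffSeq, powSeq]
  | succ i ih =>
    rw [divDiffSeq, ih]
    simp only [divDiffSeq, powSeq, rightSeq, smul_mul_assoc, one_mul, pow_succ']
    module

/-- The divided difference functional of the measure `(b - x) dσ`. -/
theorem momentPair_divDiffSeq_rightSeq (b : ℝ) (s : ℕ → Matrix (Fin q) (Fin q) ℂ) (z : ℂ)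
    (F : MatPoly q) :
    momentPair (divDiffSeq (rightSeq b s) z) F =
      -momentPair (divDiffSeq s z) (mulSub b F) + momentPair (powSeq q z) F * s 0 := by
  rw [momentPair_mulSub, ← momentPair_neg_seq, ← momentPair_mul_const, ← momentPair_add_seq]
  congr 2
  funext i
  exact divDiffSeq_rightSeq b s z i

theorem leftSeq_rightSeq (a b : ℝ) (s : ℕ → Matrix (Fin q) (Fin q) ℂ) :
    leftSeq a (rightSeq b s) = hatSeq a b s := by
  funext k
  simp only [leftSeq, rightSeq, hatSeq]
  module

/-! ### Orthogonal matrix polynomials -/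

/-- The matrix polynomial whose coefficients are the blocks of a block row. -/
def rowPoly {N : ℕ} (c : Matrix (Fin q) (Fin N × Fin q) ℂ) : MatPoly q :=
  ∑ i : Fin N, monomial i (Matrix.of fun x y => c x (i, y))

theorem momentPair_rowPoly {N : ℕ} (c : Matrix (Fin q) (Fin N × Fin q) ℂ)
    (w : ℕ → Matrix (Fin q) (Fin q) ℂ) :
    momentPair w (rowPoly c) = c * blockCol N w := by
  rw [rowPoly, map_sum]
  ext x y
  simp [momentPair_monomial, Matrix.sum_apply, Matrix.mul_apply, Fintype.sum_prod_type, blockCol]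

theorem coeff_rowPoly {N : ℕ} (c : Matrix (Fin q) (Fin N × Fin q) ℂ) (i : Fin N) :
    (rowPoly c).coeff i = Matrix.of fun x y => c x (i, y) := by
  simp [rowPoly, coeff_monomial, Fin.val_inj]

theorem rowPoly_mem_degreeLT {N : ℕ} (c : Matrix (Fin q) (Fin N × Fin q) ℂ) :
    rowPoly c ∈ degreeLT (Matrix (Fin q) (Fin q) ℂ) N := by
  refine Submodule.sum_mem _ fun i _ => ?_
  rw [mem_degreeLT]
  exact (degree_monomial_le _ _).trans_lt (by exact_mod_cast i.2)

theorem eq_rowPoly_of_mem_degreeLT {N : ℕ} {F : MatPoly q}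
    (hF : F ∈ degreeLT (Matrix (Fin q) (Fin q) ℂ) N) :
    F = rowPoly (Matrix.of fun x (y : Fin N × Fin q) => F.coeff y.1 x y.2) := by
  ext1 m
  by_cases hm : m < N
  · rw [coeff_rowPoly _ (⟨m, hm⟩ : Fin N)]
    rfl
  · rw [mem_degreeLT, degree_lt_iff_coeff_zero] at hF
    have h := rowPoly_mem_degreeLT (Matrix.of fun x (y : Fin N × Fin q) => F.coeff y.1 x y.2)
    rw [mem_degreeLT, degree_lt_iff_coeff_zero] at h
    rw [hF m (by omega), h m (by omega)]

/-- `F` is orthogonal to the powers `X^k`, `k < N`, with respect to the moments `t`. -/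
def IsOrth (t : ℕ → Matrix (Fin q) (Fin q) ℂ) (N : ℕ) (F : MatPoly q) : Prop :=
  ∀ k < N, momentPair (fun i => t (i + k)) F = 0

theorem mul_hankel_eq_zero {t : ℕ → Matrix (Fin q) (Fin q) ℂ} {N : ℕ}
    (c : Matrix (Fin q) (Fin N × Fin q) ℂ)
    (h : ∀ k < N, c * blockCol N (fun i => t (i + k)) = 0) : c * hankel t N = 0 := by
  ext x ⟨k, y⟩
  exact congrFun (congrFun (h k k.2) x) y

/-- The orthogonality relations say that the coefficient row is annihilated by the invertible Hankel
matrix. -/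
theorem IsOrth.eq_zero {t : ℕ → Matrix (Fin q) (Fin q) ℂ} {N : ℕ}
    {F : MatPoly q} (ht : IsUnit (hankel t N)) (h : IsOrth t N F)
    (hF : F ∈ degreeLT (Matrix (Fin q) (Fin q) ℂ) N) : F = 0 := by
  rw [eq_rowPoly_of_mem_degreeLT hF] at h ⊢
  set c : Matrix (Fin q) (Fin N × Fin q) ℂ := Matrix.of fun x y => F.coeff y.1 x y.2 with hc
  have h1 : c * hankel t N = 0 := mul_hankel_eq_zero c fun k hk => by
    rw [← momentPair_rowPoly]; exact h k hk
  have h2 : c = 0 := by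
    have := congrArg (· * (hankel t N)⁻¹) h1
    simpa [Matrix.mul_nonsing_inv_cancel_right _ _ ((Matrix.isUnit_iff_isUnit_det _).1 ht)]
      using this
  rw [h2, rowPoly]
  refine Finset.sum_eq_zero fun i _ => ?_
  exact (monomial (i : ℕ)).map_zero

theorem IsOrth.sub {t : ℕ → Matrix (Fin q) (Fin q) ℂ} {N : ℕ}
    {F G : MatPoly q} (hF : IsOrth t N F) (hG : IsOrth t N G) :
    IsOrth t N (F - G) := fun k hk => by rw [map_sub, hF k hk, hG k hk, sub_zero]

theorem IsOrth.smul {t : ℕ → Matrix (Fin q) (Fin q) ℂ} {N : ℕ}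
    {F : MatPoly q} (hF : IsOrth t N F) (r : Matrix (Fin q) (Fin q) ℂ) :
    IsOrth t N (r • F) := fun k hk => by rw [map_smul, hF k hk, smul_zero]

/-- The monic orthogonal polynomial of degree `N`. -/
def monicPoly (t : ℕ → Matrix (Fin q) (Fin q) ℂ) (N : ℕ) : MatPoly q :=
  rowPoly (monicRow t N)

theorem coeff_monicPoly (t : ℕ → Matrix (Fin q) (Fin q) ℂ) (N : ℕ) :
    (monicPoly t N).coeff N = 1 := by
  have := coeff_rowPoly (monicRow t N) (Fin.last N)
  rw [Fin.val_last] at this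
  rw [monicPoly, this]
  ext x y
  simp [monicRow]

/-- Self-adjointness of t_N, …, t_{2N-1} turns the row Y* of the definition into the row of moments
that the last coefficient contributes. -/
theorem isOrth_monicPoly {t : ℕ → Matrix (Fin q) (Fin q) ℂ} {N : ℕ}
    (ht : IsUnit (hankel t N)) (hs : ∀ k < 2 * N, (t k)ᴴ = t k) :
    IsOrth t N (monicPoly t N) := by
  intro k hk
  rw [monicPoly, momentPair_rowPoly]
  have h1 : (-((blockCol N fun k => t (N + k))ᴴ * (hankel t N)⁻¹)) * hankel t N =
      -(blockCol N fun k => t (N + k))ᴴ := by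
    rw [Matrix.neg_mul,
      Matrix.nonsing_inv_mul_cancel_right _ _ ((Matrix.isUnit_iff_isUnit_det _).1 ht)]
  ext x y
  have h2 := congrFun (congrFun h1 x) (⟨k, hk⟩, y)
  rw [Matrix.mul_apply, Fintype.sum_prod_type] at h2
  rw [Matrix.mul_apply, Fintype.sum_prod_type, Fin.sum_univ_castSucc]
  have h3 : (t (N + k))ᴴ x y = t (N + k) x y := by rw [hs _ (by omega)]
  rw [Matrix.conjTranspose_apply] at h3
  simp only [monicRow, blockCol, Matrix.of_apply, Fin.lastCases_last, Fin.lastCases_castSucc,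
    Fin.val_castSucc, Fin.val_last]
  simp only [hankel, blockMat, Matrix.of_apply, Matrix.neg_apply, Matrix.conjTranspose_apply,
    blockCol] at h2 ⊢
  rw [h2, h3]
  simp [Matrix.one_apply]

theorem IsOrth.eq_coeff_smul_monicPoly {t : ℕ → Matrix (Fin q) (Fin q) ℂ} {N : ℕ}
    {F : MatPoly q} (ht : IsUnit (hankel t N))
    (hs : ∀ k < 2 * N, (t k)ᴴ = t k) (h : IsOrth t N F)
    (hF : F ∈ degreeLT (Matrix (Fin q) (Fin q) ℂ) (N + 1)) :
    F = F.coeff N • monicPoly t N := by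
  rw [← sub_eq_zero]
  refine (h.sub ((isOrth_monicPoly ht hs).smul _)).eq_zero ht ?_
  have hm := rowPoly_mem_degreeLT (monicRow t N)
  rw [mem_degreeLT, degree_lt_iff_coeff_zero] at *
  intro m hm'
  rcases hm'.eq_or_lt with rfl | hlt
  · simp [coeff_monicPoly]
  · rw [coeff_sub, hF m hlt, coeff_smul, monicPoly, hm m hlt, smul_zero, sub_zero]

/-- The normalized F is a left multiple of the monic polynomial, so φ of the latter has a left
inverse. All invertibility claims of the theorem come from exhibiting such an F. -/
theorem IsOrth.isUnit_apply_monicPoly {t : ℕ → Matrix (Fin q) (Fin q) ℂ} {N : ℕ}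
    {F : MatPoly q} (ht : IsUnit (hankel t N))
    (hs : ∀ k < 2 * N, (t k)ᴴ = t k) (h : IsOrth t N F)
    (hF : F ∈ degreeLT (Matrix (Fin q) (Fin q) ℂ) (N + 1))
    (φ : MatPoly q →ₗ[Matrix (Fin q) (Fin q) ℂ] Matrix (Fin q) (Fin q) ℂ)
    (hφ : φ F = 1) : IsUnit (φ (monicPoly t N)) := by
  rw [h.eq_coeff_smul_monicPoly ht hs hF, map_smul, smul_eq_mul] at hφ
  exact IsUnit.of_mul_eq_one_right _ hφ

theorem IsOrth.eq_inv_smul_monicPoly {t : ℕ → Matrix (Fin q) (Fin q) ℂ} {N : ℕ}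
    {F : MatPoly q} (ht : IsUnit (hankel t N))
    (hs : ∀ k < 2 * N, (t k)ᴴ = t k) (h : IsOrth t N F)
    (hF : F ∈ degreeLT (Matrix (Fin q) (Fin q) ℂ) (N + 1))
    (φ : MatPoly q →ₗ[Matrix (Fin q) (Fin q) ℂ] Matrix (Fin q) (Fin q) ℂ)
    (hφ : φ F = 1) : (φ (monicPoly t N))⁻¹ • monicPoly t N = F := by
  have h1 := h.eq_coeff_smul_monicPoly ht hs hF
  have h2 := hφ
  rw [h1, map_smul, smul_eq_mul] at h2
  rw [Matrix.inv_eq_left_inv h2, ← h1]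

/-- Any F normalized by some functional φ generates the rank-one module of orthogonal polynomials,
and φ reads off the coefficient. Every recurrence and connection formula below is an instance. -/
theorem IsOrth.eq_apply_smul {t : ℕ → Matrix (Fin q) (Fin q) ℂ} {N : ℕ}
    {F G : MatPoly q} (ht : IsUnit (hankel t N))
    (hs : ∀ k < 2 * N, (t k)ᴴ = t k) (hG : IsOrth t N G)
    (hG' : G ∈ degreeLT (Matrix (Fin q) (Fin q) ℂ) (N + 1)) (hF : IsOrth t N F)
    (hF' : F ∈ degreeLT (Matrix (Fin q) (Fin q) ℂ) (N + 1))
    (φ : MatPoly q →ₗ[Matrix (Fin q) (Fin q) ℂ] Matrix (Fin q) (Fin q) ℂ)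
    (hφ : φ F = 1) : G = φ G • F := by
  have h1 := hG.eq_coeff_smul_monicPoly ht hs hG'
  have h2 := hF.eq_inv_smul_monicPoly ht hs hF' φ hφ
  have h3 := hF.isUnit_apply_monicPoly ht hs hF' φ hφ
  conv_rhs => rw [h1, map_smul, ← h2, smul_eq_mul, smul_smul]
  rw [Matrix.mul_nonsing_inv_cancel_right _ _ ((Matrix.isUnit_iff_isUnit_det _).1 h3), ← h1]

end THMM
end

/-! ### Block resolvents as evaluations and divided differences -/

noncomputable section

namespace THMM

open Polynomial

variable {q : ℕ}

theorem shiftT_mul_zero {κ : Type*} (j : ℕ) (A : Matrix (Fin (j + 1) × Fin q) κ ℂ) (x : Fin q)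
    (y : κ) : (shiftT q j * A) (0, x) y = 0 := by
  rw [Matrix.mul_apply]
  exact Finset.sum_eq_zero fun k _ => by simp [shiftT, blockMat]

theorem shiftT_mul_succ {κ : Type*} (j : ℕ) (A : Matrix (Fin (j + 1) × Fin q) κ ℂ) (i : Fin j)
    (x : Fin q) (y : κ) : (shiftT q j * A) (i.succ, x) y = A (i.castSucc, x) y := by
  rw [Matrix.mul_apply, Finset.sum_eq_single (i.castSucc, x)]
  · simp [shiftT, blockMat]
  · rintro ⟨k, x'⟩ _ hk
    by_cases hik : (i : ℕ) = k
    · have h1 : k = i.castSucc := by ext; simp [hik]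
      have h2 : x ≠ x' := fun h => hk (by rw [h1, h])
      simp [shiftT, blockMat, hik, Matrix.one_apply_ne h2]
    · simp [shiftT, blockMat, hik]
  · simp

/-- The shift is nilpotent; the inverse is the finite geometric series, with blocks z^{i-k} on and
below the diagonal. -/
theorem isUnit_one_sub_smul_shiftT (j : ℕ) (z : ℂ) :
    IsUnit (1 - z • shiftT q j : Matrix (Fin (j + 1) × Fin q) (Fin (j + 1) × Fin q) ℂ) := by
  have h : (1 - z • shiftT q j) *
      blockMat (j + 1) (j + 1) (fun i k => if k ≤ i then powSeq q z (i - k) else 0) = 1 := by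
    ext ⟨i, x⟩ ⟨k, y⟩
    rw [sub_mul, one_mul, smul_mul_assoc, Matrix.sub_apply, Matrix.smul_apply]
    induction i using Fin.cases with
    | zero =>
      rw [shiftT_mul_zero]
      rcases Nat.eq_zero_or_pos (k : ℕ) with hk | hk
      · have : k = 0 := by ext; simp [hk]
        subst this
        simp [blockMat, powSeq, Matrix.one_apply]
      · have : k ≠ 0 := fun h => by simp [h] at hk
        simp [blockMat, this, this.symm]
    | succ i =>
      rw [shiftT_mul_succ]
      rcases lt_trichotomy (k : ℕ) (i + 1) with hk | hk | hk
      · have h1 : i.succ ≠ k := fun h => by simp [← h] at hk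
        have h2 : (i : ℕ) + 1 - k = (i - k) + 1 := by omega
        have h3 : k ≤ i.succ := hk.le
        have h4 : k ≤ i.castSucc := Nat.lt_succ_iff.1 hk
        simp [blockMat, h1, h2, h3, h4, powSeq, pow_succ', mul_assoc]
      · have : k = i.succ := by ext; simp [hk]
        subst this
        simp [blockMat, powSeq, Matrix.one_apply]
      · have h1 : i.succ ≠ k := fun h => by simp [← h] at hk
        have h2 : ¬ k ≤ i.succ := not_le.2 hk
        have h3 : ¬ k ≤ i.castSucc := fun h => h2 (h.trans (Fin.castSucc_le_succ i))
        simp [blockMat, h1, h2, h3]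
  exact IsUnit.of_mul_eq_one _ h

/-- Applying R_j(z) solves the first-order recurrence with forcing x, so each column formula below
only needs its solution checked. -/
theorem resolvR_mul_blockCol (j : ℕ) (z : ℂ) {x y : ℕ → Matrix (Fin q) (Fin q) ℂ}
    (h0 : y 0 = x 0) (h : ∀ i, y (i + 1) = z • y i + x (i + 1)) :
    resolvR q j z * blockCol (j + 1) x = blockCol (j + 1) y := by
  have h1 : blockCol (j + 1) x = (1 - z • shiftT q j) * blockCol (j + 1) y := by
    ext ⟨i, r⟩ c
    rw [Matrix.sub_mul, Matrix.one_mul, Matrix.smul_mul, Matrix.sub_apply, Matrix.smul_apply]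
    induction i using Fin.cases with
    | zero => rw [shiftT_mul_zero]; simp [blockCol, h0]
    | succ i => rw [shiftT_mul_succ]; simp [blockCol, h]
  rw [h1, resolvR, Matrix.nonsing_inv_mul_cancel_left _ _
    ((Matrix.isUnit_iff_isUnit_det _).1 (isUnit_one_sub_smul_shiftT j z))]

theorem resolvR_mul_colV (j : ℕ) (z : ℂ) :
    resolvR q j z * colV q j = blockCol (j + 1) (powSeq q z) :=
  resolvR_mul_blockCol j z (by simp [powSeq]) fun i => by simp [powSeq, pow_succ', mul_smul]

theorem resolvR_mul_colU1 (s : ℕ → Matrix (Fin q) (Fin q) ℂ) (j : ℕ) (z : ℂ) :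
    resolvR q j z * colU1 s j = blockCol (j + 1) (fun i => -divDiffSeq s z i) :=
  resolvR_mul_blockCol j z (by simp [divDiffSeq]) fun i => by simp only [divDiffSeq]; module

/-- The summand z v_j s_0 is accounted for by the weight (x - a)(x - b): its divided difference is x
+ z - a - b, which contains z. -/
theorem resolvR_mul_colU2 (a b : ℝ) (s : ℕ → Matrix (Fin q) (Fin q) ℂ) (j : ℕ) (z : ℂ) :
    resolvR q j z * (colU2 a b s j + z • (colV q j * s 0)) =
      blockCol (j + 1) (fun i => (divDiffSeq s z (i + 1 + 1) - (b : ℂ) • divDiffSeq s z (i + 1)) -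
        (a : ℂ) • (divDiffSeq s z (i + 1) - (b : ℂ) • divDiffSeq s z i)) := by
  have h : colU2 a b s j + z • (colV q j * s 0) = blockCol (j + 1) (fun i => match i with
      | 0 => -((a + b : ℂ) • s 0) + s 1 + z • s 0
      | i + 1 => -hatSeq a b s i) := by
    ext ⟨i, r⟩ c
    induction i using Fin.cases with
    | zero =>
      simp [colU2, blockCol, colV, Matrix.mul_apply, Matrix.one_apply]
    | succ i =>
      simp [colU2, blockCol, colV, Matrix.mul_apply]
  rw [h]
  refine resolvR_mul_blockCol j z ?_ fun i => ?_
  · simp only [divDiffSeq, smul_zero, zero_add]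
    module
  · simp only [divDiffSeq, hatSeq]
    module

theorem resolvR_mul_colUt1 (b : ℝ) (s : ℕ → Matrix (Fin q) (Fin q) ℂ) (j : ℕ) (z : ℂ) :
    resolvR q j z * colUt1 b s j =
      blockCol (j + 1) (fun i => divDiffSeq s z (i + 1) - (b : ℂ) • divDiffSeq s z i) :=
  resolvR_mul_blockCol j z (by simp [divDiffSeq]) fun i => by simp only [divDiffSeq]; module

theorem resolvR_mul_colUt2 (a : ℝ) (s : ℕ → Matrix (Fin q) (Fin q) ℂ) (j : ℕ) (z : ℂ) :
    resolvR q j z * colUt2 a s j =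
      blockCol (j + 1) (fun i => -(divDiffSeq s z (i + 1) - (a : ℂ) • divDiffSeq s z i)) :=
  resolvR_mul_blockCol j z (by simp [divDiffSeq]) fun i => by simp only [divDiffSeq]; module

theorem P1_eq (s : ℕ → Matrix (Fin q) (Fin q) ℂ) (j : ℕ) (z : ℂ) :
    P1 s j z = momentPair (powSeq q z) (monicPoly s j) := by
  rw [P1, Matrix.mul_assoc, resolvR_mul_colV, monicPoly, momentPair_rowPoly]

theorem P2_eq (a b : ℝ) (s : ℕ → Matrix (Fin q) (Fin q) ℂ) (j : ℕ) (z : ℂ) :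
    P2 a b s j z = momentPair (powSeq q z) (monicPoly (hatSeq a b s) j) := P1_eq _ _ _

theorem Gamma1_eq (b : ℝ) (s : ℕ → Matrix (Fin q) (Fin q) ℂ) (j : ℕ) (z : ℂ) :
    Gamma1 b s j z = momentPair (powSeq q z) (monicPoly (rightSeq b s) j) := P1_eq _ _ _

theorem Gamma2_eq (a : ℝ) (s : ℕ → Matrix (Fin q) (Fin q) ℂ) (j : ℕ) (z : ℂ) :
    Gamma2 a s j z = momentPair (powSeq q z) (monicPoly (leftSeq a s) j) := P1_eq _ _ _

theorem Q1_eq (s : ℕ → Matrix (Fin q) (Fin q) ℂ) (j : ℕ) (z : ℂ) :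
    Q1 s j z = momentPair (divDiffSeq s z) (monicPoly s j) := by
  rw [Q1, Matrix.mul_assoc, resolvR_mul_colU1, ← momentPair_rowPoly, momentPair_neg_seq, neg_neg,
    monicPoly]

theorem Q2_eq (a b : ℝ) (s : ℕ → Matrix (Fin q) (Fin q) ℂ) (j : ℕ) (z : ℂ) :
    Q2 a b s j z =
      -momentPair (divDiffSeq s z) (mulSub b (mulSub a (monicPoly (hatSeq a b s) j))) := by
  rw [Q2, Matrix.mul_assoc, resolvR_mul_colU2, ← momentPair_rowPoly, momentPair_mulSub,
    momentPair_mulSub, monicPoly]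

theorem Theta1_eq (b : ℝ) (s : ℕ → Matrix (Fin q) (Fin q) ℂ) (j : ℕ) (z : ℂ) :
    Theta1 b s j z = momentPair (divDiffSeq s z) (mulSub b (monicPoly (rightSeq b s) j)) := by
  rw [Theta1, Matrix.mul_assoc, resolvR_mul_colUt1, ← momentPair_rowPoly, momentPair_mulSub,
    monicPoly]

theorem Theta2_eq (a : ℝ) (s : ℕ → Matrix (Fin q) (Fin q) ℂ) (j : ℕ) (z : ℂ) :
    Theta2 a s j z = -momentPair (divDiffSeq s z) (mulSub a (monicPoly (leftSeq a s) j)) := by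
  rw [Theta2, Matrix.mul_assoc, resolvR_mul_colUt2, ← momentPair_rowPoly, momentPair_mulSub,
    momentPair_neg_seq, monicPoly]

/-- The matrix polynomial of degree `< N` representing, with respect to the moments `g`, the
functional with (adjoint) moments `w`. -/
def reprPoly (g : ℕ → Matrix (Fin q) (Fin q) ℂ) (N : ℕ) (w : ℕ → Matrix (Fin q) (Fin q) ℂ) :
    MatPoly q :=
  rowPoly ((blockCol N w)ᴴ * (hankel g N)⁻¹)

theorem momentPair_reprPoly (g w u : ℕ → Matrix (Fin q) (Fin q) ℂ) (N : ℕ) :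
    momentPair u (reprPoly g N w) = (blockCol N w)ᴴ * (hankel g N)⁻¹ * blockCol N u :=
  momentPair_rowPoly _ _

theorem reprPoly_zero (g w : ℕ → Matrix (Fin q) (Fin q) ℂ) : reprPoly g 0 w = 0 := by
  simp [reprPoly, rowPoly]

theorem reprPoly_mem_degreeLT (g w : ℕ → Matrix (Fin q) (Fin q) ℂ) (N : ℕ) :
    reprPoly g N w ∈ degreeLT (Matrix (Fin q) (Fin q) ℂ) N :=
  rowPoly_mem_degreeLT _

theorem momentPair_shift_reprPoly {g : ℕ → Matrix (Fin q) (Fin q) ℂ} {N : ℕ}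
    (hg : IsUnit (hankel g N)) (w : ℕ → Matrix (Fin q) (Fin q) ℂ) {k : ℕ} (hk : k < N) :
    momentPair (fun i => g (i + k)) (reprPoly g N w) = (w k)ᴴ := by
  have h1 : (blockCol N w)ᴴ * (hankel g N)⁻¹ * hankel g N = (blockCol N w)ᴴ :=
    Matrix.nonsing_inv_mul_cancel_right _ _ ((Matrix.isUnit_iff_isUnit_det _).1 hg)
  rw [momentPair_reprPoly]
  ext x y
  have h2 := congrFun (congrFun h1 x) (⟨k, hk⟩, y)
  simpa [Matrix.mul_apply, hankel, blockMat, blockCol] using h2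

/-- The value is a quadratic form w*G⁻¹w. It makes the parameters Hermitian, so that the adjoints
produced by `pairMat` can be dropped. -/
theorem isHermitian_momentPair_reprPoly {g : ℕ → Matrix (Fin q) (Fin q) ℂ} {N : ℕ}
    (hg : (hankel g N).IsHermitian) (w : ℕ → Matrix (Fin q) (Fin q) ℂ) :
    (momentPair w (reprPoly g N w)).IsHermitian := by
  rw [momentPair_reprPoly, Matrix.IsHermitian, Matrix.conjTranspose_mul, Matrix.conjTranspose_mul,
    Matrix.conjTranspose_conjTranspose, Matrix.conjTranspose_nonsing_inv, hg, Matrix.mul_assoc]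

theorem conjTranspose_powSeq (a : ℝ) (k : ℕ) : (powSeq q a k)ᴴ = powSeq q a k := by
  simp [powSeq, Matrix.conjTranspose_smul]

end THMM
end

/-! ### Kernel and Markov polynomials, their recurrences and the parameters -/

noncomputable section

namespace THMM

open Polynomial

variable {q : ℕ}

/-- The reproducing kernel of the moments `t` at the point `a`, of degree `< N`. -/
def kernelPoly (a : ℝ) (t : ℕ → Matrix (Fin q) (Fin q) ℂ) (N : ℕ) :
    MatPoly q :=
  reprPoly t N (powSeq q a)

/-- The matrix polynomial of degree `< N` that represents the functional `t` with respect to the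
moments `leftSeq a t`. -/
def markovPoly (a : ℝ) (t : ℕ → Matrix (Fin q) (Fin q) ℂ) (N : ℕ) :
    MatPoly q :=
  reprPoly (leftSeq a t) N t

/-- The orthogonal polynomial of degree `N` normalized by the value `1` at `a`. -/
def unitPoly (a : ℝ) (t : ℕ → Matrix (Fin q) (Fin q) ℂ) (N : ℕ) :
    MatPoly q :=
  1 - mulSub a (markovPoly a t N)

section Recurrences

variable {a : ℝ} {t : ℕ → Matrix (Fin q) (Fin q) ℂ} {N : ℕ}

theorem momentPair_shift_kernelPoly (ht : IsUnit (hankel t N)) {k : ℕ} (hk : k < N) :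
    momentPair (fun i => t (i + k)) (kernelPoly a t N) = powSeq q a k := by
  rw [kernelPoly, momentPair_shift_reprPoly ht _ hk, conjTranspose_powSeq]

theorem momentPair_kernelPoly (ht : IsUnit (hankel t (N + 1))) :
    momentPair t (kernelPoly a t (N + 1)) = 1 := by
  have := momentPair_shift_kernelPoly (a := a) ht (Nat.succ_pos N)
  simpa [powSeq] using this

/-- The reproducing property evaluates (x - a)x^k at a, which gives zero. -/
theorem isOrth_kernelPoly (ht : IsUnit (hankel t (N + 1))) :
    IsOrth (leftSeq a t) N (kernelPoly a t (N + 1)) := by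
  intro k hk
  rw [momentPair_leftSeq, momentPair_mulSub]
  have h1 := momentPair_shift_kernelPoly (a := a) ht (show k < N + 1 by omega)
  have h2 := momentPair_shift_kernelPoly (a := a) ht (show k + 1 < N + 1 by omega)
  have h3 : (fun i => t (i + 1 + k) - (a : ℂ) • t (i + k)) =
      fun i => t (i + (k + 1)) + (-(a : ℂ)) • t (i + k) := by
    funext i
    rw [add_right_comm i 1 k, neg_smul, sub_eq_add_neg, add_assoc]
  rw [h3, momentPair_add_seq, momentPair_smul_seq, h1, h2, powSeq, powSeq, pow_succ', mul_smul]
  module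

theorem kernelPoly_mem_degreeLT (a : ℝ) (t : ℕ → Matrix (Fin q) (Fin q) ℂ) (N : ℕ) :
    kernelPoly a t N ∈ degreeLT (Matrix (Fin q) (Fin q) ℂ) N :=
  reprPoly_mem_degreeLT _ _ _

theorem one_mem_degreeLT (N : ℕ) :
    (1 : MatPoly q) ∈ degreeLT (Matrix (Fin q) (Fin q) ℂ) (N + 1) := by
  rw [mem_degreeLT]
  exact degree_one_le.trans_lt (by exact_mod_cast Nat.succ_pos N)

theorem unitPoly_mem_degreeLT (a : ℝ) (t : ℕ → Matrix (Fin q) (Fin q) ℂ) (N : ℕ) :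
    unitPoly a t N ∈ degreeLT (Matrix (Fin q) (Fin q) ℂ) (N + 1) :=
  Submodule.sub_mem _ (one_mem_degreeLT N)
    (mulSub_mem_degreeLT _ (reprPoly_mem_degreeLT _ _ _))

theorem momentPair_powSeq_unitPoly (a : ℝ) (t : ℕ → Matrix (Fin q) (Fin q) ℂ) (N : ℕ) :
    momentPair (powSeq q a) (unitPoly a t N) = 1 := by
  rw [unitPoly, map_sub, momentPair_one, momentPair_powSeq_mulSub, sub_self, zero_smul, sub_zero,
    powSeq, pow_zero, one_smul]

theorem momentPair_divDiffSeq_unitPoly (a : ℝ) (t : ℕ → Matrix (Fin q) (Fin q) ℂ) (N : ℕ) :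
    momentPair (divDiffSeq t a) (unitPoly a t N) = -momentPair t (markovPoly a t N) := by
  rw [unitPoly, map_sub, momentPair_one, momentPair_divDiffSeq_mulSub, sub_self, zero_smul,
    zero_add, divDiffSeq, zero_sub]

/-- By the choice of M_N, the moments of (x - a)M_N against x^k are t_k* = t_k and cancel those of
1. -/
theorem isOrth_unitPoly (ht : IsUnit (hankel (leftSeq a t) N)) (hs : ∀ k < N, (t k)ᴴ = t k) :
    IsOrth t N (unitPoly a t N) := by
  intro k hk
  rw [unitPoly, map_sub, ← momentPair_leftSeq, markovPoly, momentPair_shift_reprPoly ht _ hk,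
    hs k hk, momentPair_one, zero_add, sub_self]

theorem momentPair_unitPoly (ht : IsUnit (hankel (leftSeq a t) (N + 1)))
    (hs : ∀ k < N + 1, (t k)ᴴ = t k) : momentPair t (unitPoly a t (N + 1)) = 0 :=
  isOrth_unitPoly ht hs 0 (Nat.succ_pos N)

theorem degreeLT_le_succ (N : ℕ) :
    degreeLT (Matrix (Fin q) (Fin q) ℂ) N ≤ degreeLT (Matrix (Fin q) (Fin q) ℂ) (N + 1) :=
  degreeLT_mono (Nat.le_succ N)

/-- Both kernels reproduce values at a in degree < N, so their difference is orthogonal for t; its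
value at a is the coefficient. -/
theorem kernelPoly_succ (ht : IsUnit (hankel t N)) (ht' : IsUnit (hankel t (N + 1)))
    (hl : IsUnit (hankel (leftSeq a t) N)) (hs : ∀ k < 2 * N, (t k)ᴴ = t k) :
    kernelPoly a t (N + 1) = kernelPoly a t N +
      (momentPair (powSeq q a) (kernelPoly a t (N + 1)) -
        momentPair (powSeq q a) (kernelPoly a t N)) • unitPoly a t N := by
  rw [← map_sub, ← sub_eq_iff_eq_add']
  refine IsOrth.eq_apply_smul ht hs ?_ ?_ (isOrth_unitPoly hl fun k hk => hs k (by omega))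
    (unitPoly_mem_degreeLT a t N) _ (momentPair_powSeq_unitPoly a t N)
  · intro k hk
    rw [map_sub, momentPair_shift_kernelPoly ht hk, momentPair_shift_kernelPoly ht' (by omega),
      sub_self]
  · exact Submodule.sub_mem _ (kernelPoly_mem_degreeLT _ _ _)
      (degreeLT_le_succ N (kernelPoly_mem_degreeLT _ _ _))

theorem conjTranspose_leftSeq {k : ℕ} (h : (t k)ᴴ = t k) (h' : (t (k + 1))ᴴ = t (k + 1)) :
    (leftSeq a t k)ᴴ = leftSeq a t k := by
  simp [leftSeq, Matrix.conjTranspose_smul, h, h']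

theorem conjTranspose_rightSeq {b : ℝ} {k : ℕ} (h : (t k)ᴴ = t k)
    (h' : (t (k + 1))ᴴ = t (k + 1)) : (rightSeq b t k)ᴴ = rightSeq b t k := by
  simp [rightSeq, Matrix.conjTranspose_smul, h, h']

/-- Both polynomials represent the same functional in degree < N, so their difference is orthogonal
for the weight x - a; the generator is the next kernel, whose integral is 1. -/
theorem markovPoly_succ (ht : IsUnit (hankel t (N + 1))) (hl : IsUnit (hankel (leftSeq a t) N))
    (hl' : IsUnit (hankel (leftSeq a t) (N + 1))) (hs : ∀ k < 2 * N + 1, (t k)ᴴ = t k) :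
    markovPoly a t (N + 1) = markovPoly a t N +
      (momentPair t (markovPoly a t (N + 1)) - momentPair t (markovPoly a t N)) •
        kernelPoly a t (N + 1) := by
  rw [← map_sub, ← sub_eq_iff_eq_add']
  refine IsOrth.eq_apply_smul hl (fun k hk => conjTranspose_leftSeq (hs k (by omega))
    (hs (k + 1) (by omega))) ?_ ?_ (isOrth_kernelPoly ht)
    (kernelPoly_mem_degreeLT a t _) _ (momentPair_kernelPoly ht)
  · intro k hk
    rw [map_sub, markovPoly, markovPoly, momentPair_shift_reprPoly hl _ hk,
      momentPair_shift_reprPoly hl' _ (by omega), sub_self]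
  · exact Submodule.sub_mem _ (reprPoly_mem_degreeLT _ _ _)
      (degreeLT_le_succ N (reprPoly_mem_degreeLT _ _ _))

theorem quadAt_colV (a : ℝ) (t : ℕ → Matrix (Fin q) (Fin q) ℂ) (j : ℕ) :
    quadAt a j (hankel t (j + 1)) (colV q j) =
      momentPair (powSeq q a) (kernelPoly a t (j + 1)) := by
  rw [quadAt, ← Matrix.conjTranspose_mul, Matrix.mul_assoc _ (resolvR q j a), resolvR_mul_colV,
    kernelPoly, momentPair_reprPoly]

theorem divDiffSeq_succ_sub (a : ℂ) (t : ℕ → Matrix (Fin q) (Fin q) ℂ) (i : ℕ) :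
    divDiffSeq t a (i + 1) - a • divDiffSeq t a i = t i := by
  rw [divDiffSeq, add_sub_cancel_left]

theorem blockCol_neg (M : ℕ) (w : ℕ → Matrix (Fin q) (Fin q) ℂ) :
    blockCol M (fun i => -w i) = -blockCol M w := rfl

theorem quadAt_colUt2 (a : ℝ) (t : ℕ → Matrix (Fin q) (Fin q) ℂ) (j : ℕ) :
    quadAt a j (K2 a t (j + 1)) (colUt2 a t j) = momentPair t (markovPoly a t (j + 1)) := by
  rw [quadAt, ← Matrix.conjTranspose_mul, Matrix.mul_assoc _ (resolvR q j a), resolvR_mul_colUt2,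
    markovPoly, momentPair_reprPoly]
  simp only [divDiffSeq_succ_sub, blockCol_neg, Matrix.conjTranspose_neg, Matrix.neg_mul,
    Matrix.mul_neg, neg_neg]
  rfl

/-- The kernel of degree < 1 is a constant C with C t_0 = 1. This fits M_0 = s_0⁻¹ into the pattern
of increments, the kernel for N = 0 being zero. -/
theorem momentPair_powSeq_kernelPoly_one (ht : IsUnit (hankel t 1)) :
    momentPair (powSeq q a) (kernelPoly a t 1) = (t 0)⁻¹ := by
  have h1 := momentPair_kernelPoly (a := a) ht
  have h2 := eq_rowPoly_of_mem_degreeLT (kernelPoly_mem_degreeLT a t 1)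
  rw [rowPoly, Fin.sum_univ_one] at h2
  rw [zero_add, h2, momentPair_monomial] at h1
  have h3 : (t 0)⁻¹ = _ := Matrix.inv_eq_left_inv h1
  rw [h2, momentPair_monomial, h3]
  simp [powSeq]

theorem bigMPar_eq (ht : IsUnit (hankel t 1)) (k : ℕ) :
    bigMPar a t k = momentPair (powSeq q a) (kernelPoly a t (k + 1)) -
        momentPair (powSeq q a) (kernelPoly a t k) := by
  cases k with
  | zero =>
    rw [bigMPar, zero_add, momentPair_powSeq_kernelPoly_one ht, kernelPoly, reprPoly_zero, map_zero,
      sub_zero]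
  | succ k => rw [bigMPar, H1, H1, quadAt_colV, quadAt_colV]

theorem bigLPar_eq (a : ℝ) (t : ℕ → Matrix (Fin q) (Fin q) ℂ) (k : ℕ) :
    bigLPar a t k = momentPair t (markovPoly a t (k + 1)) - momentPair t (markovPoly a t k) := by
  cases k with
  | zero =>
    have h : colUt2 a t 0 = -blockCol 1 t := by
      ext ⟨i, x⟩ y
      fin_cases i
      rfl
    rw [bigLPar, h, markovPoly, markovPoly, reprPoly_zero, map_zero, sub_zero, momentPair_reprPoly,
      Matrix.conjTranspose_neg, Matrix.neg_mul, Matrix.neg_mul, Matrix.mul_neg, neg_neg]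
    rfl
  | succ k => rw [bigLPar, quadAt_colUt2, quadAt_colUt2]

theorem mPar_eq (a b : ℝ) (s : ℕ → Matrix (Fin q) (Fin q) ℂ) (k : ℕ) :
    mPar a b s k = momentPair (powSeq q a) (kernelPoly a (rightSeq b s) (k + 1)) -
        momentPair (powSeq q a) (kernelPoly a (rightSeq b s) k) := by
  cases k with
  | zero =>
    rw [mPar, K1, quadAt_colV, kernelPoly, kernelPoly, reprPoly_zero, map_zero, sub_zero]
  | succ k => rw [mPar, K1, K1, quadAt_colV, quadAt_colV]

theorem lSum_eq (a b : ℝ) {s : ℕ → Matrix (Fin q) (Fin q) ℂ} (hs : (s 0)ᴴ = s 0) (j : ℕ) :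
    lSum a b s j =
      momentPair (rightSeq b s) (markovPoly a (rightSeq b s) (j + 1)) := by
  have h : (colU2 a b s j)ᴴ + (a : ℂ) • (s 0 * (colV q j)ᴴ) =
      (colU2 a b s j + (a : ℂ) • (colV q j * s 0))ᴴ := by
    simp [Matrix.conjTranspose_smul, hs]
  -- At z = a the factor x - a cancels the denominator, leaving the moments of (x - b)dσ. Their sign
  -- disappears in the quadratic form.
  have h2 : (fun i => (divDiffSeq s a (i + 1 + 1) - (b : ℂ) • divDiffSeq s a (i + 1)) -
        (a : ℂ) • (divDiffSeq s a (i + 1) - (b : ℂ) • divDiffSeq s a i)) =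
      fun i => -rightSeq b s i := by
    funext i
    simp only [divDiffSeq, rightSeq]
    module
  rw [lSum, h, ← Matrix.conjTranspose_mul, Matrix.mul_assoc _ (resolvR q j a), resolvR_mul_colU2,
    markovPoly, momentPair_reprPoly, h2, blockCol_neg, leftSeq_rightSeq, Matrix.conjTranspose_neg,
    Matrix.neg_mul, Matrix.neg_mul, Matrix.mul_neg, neg_neg]
  rfl

theorem lPar_succ_eq (a b : ℝ) {s : ℕ → Matrix (Fin q) (Fin q) ℂ} (hs : (s 0)ᴴ = s 0) (k : ℕ) :
    lPar a b s (k + 1) =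
      momentPair (rightSeq b s) (markovPoly a (rightSeq b s) (k + 1)) -
        momentPair (rightSeq b s) (markovPoly a (rightSeq b s) k) := by
  cases k with
  | zero =>
    rw [lPar, lSum_eq a b hs, markovPoly, markovPoly, reprPoly_zero, map_zero, sub_zero]
  | succ k => rw [lPar, lSum_eq a b hs, lSum_eq a b hs]

end Recurrences

/-! ### Recurrences as triangular factors -/

/-- The `2 × 2` block matrix whose columns are the adjoints of `(1 + (z - a) E F, -(z - a) F)` and
`(-E G, G)`, where `E` is the divided difference functional. -/
def pairMat (a : ℝ) (t : ℕ → Matrix (Fin q) (Fin q) ℂ) (F G : MatPoly q)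
    (z : ℂ) : Matrix (Fin q ⊕ Fin q) (Fin q ⊕ Fin q) ℂ :=
  Matrix.fromBlocks
    (1 + (z - a) • starConj (fun w => momentPair (divDiffSeq t w) F) z)
    (-starConj (fun w => momentPair (divDiffSeq t w) G) z)
    (-((z - a) • starConj (fun w => momentPair (powSeq q w) F) z))
    (starConj (fun w => momentPair (powSeq q w) G) z)

theorem pairMat_zero_one (a : ℝ) (t : ℕ → Matrix (Fin q) (Fin q) ℂ) (z : ℂ) :
    pairMat a t 0 1 z = 1 := by
  simp [pairMat, starConj, momentPair_one, divDiffSeq, powSeq]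

theorem pairMat_mul_lower (a : ℝ) (t : ℕ → Matrix (Fin q) (Fin q) ℂ)
    (F G : MatPoly q) (z : ℂ) (A : Matrix (Fin q) (Fin q) ℂ) :
    pairMat a t F G z * lower (-((z - a) • Aᴴ)) = pairMat a t (F + A • G) G z := by
  simp only [pairMat, lower, Matrix.fromBlocks_multiply, starConj, map_add, map_smul, smul_eq_mul,
    Matrix.conjTranspose_add, Matrix.conjTranspose_mul, mul_one, mul_zero, zero_add, mul_neg,
    neg_mul, smul_neg, neg_neg, mul_smul_comm, smul_add, neg_add, add_assoc]

/-- Since ∫F = 1, the divided difference of (x - a)F at z is 1 + (z - a)E_z F, which is the upper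
left entry up to the adjoint. This is what the summand 1 in `pairMat` is for. -/
theorem pairMat_mul_upper (a : ℝ) {t : ℕ → Matrix (Fin q) (Fin q) ℂ}
    {F : MatPoly q} (hF : momentPair t F = 1)
    (G : MatPoly q) (z : ℂ) (A : Matrix (Fin q) (Fin q) ℂ) :
    pairMat a t F G z * upper Aᴴ = pairMat a t F (G - A • mulSub a F) z := by
  simp only [pairMat, upper, Matrix.fromBlocks_multiply, starConj, map_sub, map_smul, smul_eq_mul,
    Matrix.conjTranspose_sub, Matrix.conjTranspose_mul, mul_one, mul_zero, add_zero,
    momentPair_divDiffSeq_mulSub, momentPair_powSeq_mulSub, hF, Matrix.conjTranspose_add,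
    Matrix.conjTranspose_smul, Matrix.conjTranspose_one, add_mul, one_mul, smul_mul_assoc, neg_mul,
    RCLike.star_def]
  simp only [Complex.conj_conj, Complex.conj_ofReal]
  congr 1 <;> abel

theorem rightProd_zero (A : ℕ → Matrix (Fin q ⊕ Fin q) (Fin q ⊕ Fin q) ℂ) :
    rightProd 0 A = 1 := by simp [rightProd]

theorem rightProd_succ (N : ℕ) (A : ℕ → Matrix (Fin q ⊕ Fin q) (Fin q ⊕ Fin q) ℂ) :
    rightProd (N + 1) A = rightProd N A * A N := by
  simp [rightProd, List.range_succ]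

/-- One half step of the recurrence, in matrix form. -/
theorem pairMat_mul_lower_kernelPoly {a : ℝ} {t : ℕ → Matrix (Fin q) (Fin q) ℂ} {N : ℕ}
    (ht : (hankel t N).PosDef) (ht' : (hankel t (N + 1)).PosDef)
    (hl : (hankel (leftSeq a t) N).PosDef) (hs : ∀ k < 2 * N, (t k)ᴴ = t k) (z : ℂ) :
    pairMat a t (kernelPoly a t N) (unitPoly a t N) z *
      lower (-((z - a) • (momentPair (powSeq q a) (kernelPoly a t (N + 1)) -
        momentPair (powSeq q a) (kernelPoly a t N)))) =
      pairMat a t (kernelPoly a t (N + 1)) (unitPoly a t N) z := by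
  have h := kernelPoly_succ ht.isUnit ht'.isUnit hl.isUnit hs
  have h1 : (momentPair (powSeq q a) (kernelPoly a t (N + 1)) -
        momentPair (powSeq q a) (kernelPoly a t N)).IsHermitian :=
    (isHermitian_momentPair_reprPoly ht'.isHermitian _).sub
      (isHermitian_momentPair_reprPoly ht.isHermitian _)
  conv_lhs => rw [← h1, pairMat_mul_lower, ← h]

/-- The other half step of the recurrence, in matrix form. -/
theorem pairMat_mul_upper_markovPoly {a : ℝ} {t : ℕ → Matrix (Fin q) (Fin q) ℂ} {N : ℕ}
    (ht : (hankel t (N + 1)).PosDef) (hl : (hankel (leftSeq a t) N).PosDef)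
    (hl' : (hankel (leftSeq a t) (N + 1)).PosDef) (hs : ∀ k < 2 * N + 1, (t k)ᴴ = t k) (z : ℂ) :
    pairMat a t (kernelPoly a t (N + 1)) (unitPoly a t N) z *
      upper (momentPair t (markovPoly a t (N + 1)) - momentPair t (markovPoly a t N)) =
      pairMat a t (kernelPoly a t (N + 1)) (unitPoly a t (N + 1)) z := by
  have h := markovPoly_succ ht.isUnit hl.isUnit hl'.isUnit hs
  have h1 : (momentPair t (markovPoly a t (N + 1)) - momentPair t (markovPoly a t N)).IsHermitian :=
    (isHermitian_momentPair_reprPoly hl'.isHermitian _).sub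
      (isHermitian_momentPair_reprPoly hl.isHermitian _)
  have h2 : unitPoly a t (N + 1) = unitPoly a t N -
      (momentPair t (markovPoly a t (N + 1)) - momentPair t (markovPoly a t N)) •
        mulSub a (kernelPoly a t (N + 1)) := by
    rw [unitPoly, h, map_add, map_smul, ← h, unitPoly]
    abel
  conv_lhs => rw [← h1, pairMat_mul_upper a (momentPair_kernelPoly ht.isUnit), ← h2]

/-- The multiplicative decomposition of the Stieltjes resolvent matrix of the moments `t`. -/
theorem rightProd_eq_pairMat {a : ℝ} {t : ℕ → Matrix (Fin q) (Fin q) ℂ} {N : ℕ}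
    (ht : ∀ j ≤ N, (hankel t j).PosDef) (hl : ∀ j ≤ N, (hankel (leftSeq a t) j).PosDef)
    (hs : ∀ k < 2 * N, (t k)ᴴ = t k) (z : ℂ) :
    rightProd N (fun k =>
        lower (-((z - a) • (momentPair (powSeq q a) (kernelPoly a t (k + 1)) -
          momentPair (powSeq q a) (kernelPoly a t k)))) *
        upper (momentPair t (markovPoly a t (k + 1)) - momentPair t (markovPoly a t k))) =
      pairMat a t (kernelPoly a t N) (unitPoly a t N) z := by
  induction N with
  | zero =>
    rw [rightProd_zero, kernelPoly, unitPoly, markovPoly, reprPoly_zero, reprPoly_zero, map_zero,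
      sub_zero, pairMat_zero_one]
  | succ N ih =>
    rw [rightProd_succ, ih (fun j hj => ht j (by omega)) (fun j hj => hl j (by omega))
      (fun k hk => hs k (by omega)), ← mul_assoc,
      pairMat_mul_lower_kernelPoly (ht N (by omega)) (ht _ le_rfl) (hl N (by omega))
        (fun k hk => hs k (by omega)),
      pairMat_mul_upper_markovPoly (ht _ le_rfl) (hl N (by omega)) (hl _ le_rfl)
        (fun k hk => hs k (by omega))]

end THMM
end

/-! ### Positivity of the Hankel matrices -/

noncomputable section

namespace THMM

variable {q : ℕ}

theorem posDef_hankel_of_le {t : ℕ → Matrix (Fin q) (Fin q) ℂ} {N j : ℕ}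
    (h : (hankel t N).PosDef) (hj : j ≤ N) : (hankel t j).PosDef :=
  h.submatrix (e := Prod.map (Fin.castLE hj) id)
    ((Fin.castLE_injective hj).prodMap Function.injective_id)

theorem conjTranspose_of_isHermitian_hankel {t : ℕ → Matrix (Fin q) (Fin q) ℂ} {N : ℕ}
    (h : (hankel t (N + 1)).IsHermitian) {k : ℕ} (hk : k ≤ 2 * N) : (t k)ᴴ = t k := by
  ext x y
  -- For k ≤ 2N both indices min k N and k - min k N are at most N, and they add up to k.
  have h1 := congrFun (congrFun h ((⟨min k N, by omega⟩ : Fin (N + 1)), x))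
    ((⟨k - min k N, by omega⟩ : Fin (N + 1)), y)
  rw [Matrix.conjTranspose_apply] at h1 ⊢
  simp only [hankel, blockMat, Matrix.of_apply] at h1
  rwa [show k - min k N + min k N = k by omega, show min k N + (k - min k N) = k by omega] at h1

/-- The matrix of the multiplication by `X - c` from degree `< N` to degree `< N + 1`. -/
def mulSubMat (q : ℕ) (c : ℝ) (N : ℕ) : Matrix (Fin (N + 1) × Fin q) (Fin N × Fin q) ℂ :=
  blockMat (N + 1) N fun i k => if i = k + 1 then 1 else if i = k then -((c : ℂ) • 1) else 0

theorem mul_mulSubMat_apply {κ : Type*} (c : ℝ) (N : ℕ)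
    (A : Matrix κ (Fin (N + 1) × Fin q) ℂ) (x : κ) (k : Fin N) (y : Fin q) :
    (A * mulSubMat q c N) x (k, y) = A x (k.succ, y) - c * A x (k.castSucc, y) := by
  have hne : (k.succ, y) ≠ (k.castSucc, y) := fun h => by
    have := congrArg (fun p => (p.1 : ℕ)) h
    simp at this
  rw [Matrix.mul_apply, ← Finset.sum_subset (Finset.subset_univ {(k.succ, y), (k.castSucc, y)}),
    Finset.sum_pair hne]
  · simp [mulSubMat, blockMat]
    ring
  · rintro ⟨i, y'⟩ _ hi
    simp only [Finset.mem_insert, Finset.mem_singleton, not_or] at hi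
    by_cases h1 : (i : ℕ) = k + 1
    · have h2 : y' ≠ y := fun h => hi.1 (by rw [h, show i = k.succ by ext; simp [h1]])
      simp [mulSubMat, blockMat, h1, Matrix.one_apply_ne h2]
    · by_cases h3 : (i : ℕ) = k
      · have h2 : y' ≠ y := fun h => hi.2 (by rw [h, show i = k.castSucc by ext; simp [h3]])
        simp [mulSubMat, blockMat, h3, Matrix.one_apply_ne h2]
      · simp [mulSubMat, blockMat, h1, h3]

theorem conjTranspose_mulSubMat_mul_apply {κ : Type*} (c : ℝ) (N : ℕ)
    (A : Matrix (Fin (N + 1) × Fin q) κ ℂ) (x : κ) (k : Fin N) (y : Fin q) :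
    ((mulSubMat q c N)ᴴ * A) (k, y) x = A (k.succ, y) x - c * A (k.castSucc, y) x := by
  rw [← Matrix.conjTranspose_conjTranspose A, ← Matrix.conjTranspose_mul,
    Matrix.conjTranspose_apply, mul_mulSubMat_apply]
  simp

theorem conjTranspose_mulSubMat_mul_hankel_mul (c : ℝ) (N : ℕ)
    (t : ℕ → Matrix (Fin q) (Fin q) ℂ) :
    (mulSubMat q c N)ᴴ * hankel t (N + 1) * mulSubMat q c N =
      hankel (leftSeq c (leftSeq c t)) N := by
  ext ⟨i, x⟩ ⟨k, y⟩
  rw [mul_mulSubMat_apply, conjTranspose_mulSubMat_mul_apply, conjTranspose_mulSubMat_mul_apply]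
  simp only [hankel, blockMat, leftSeq, Matrix.of_apply, Fin.val_succ, Fin.val_castSucc,
    Matrix.add_apply, Matrix.neg_apply, Matrix.smul_apply, smul_eq_mul]
  rw [show (i : ℕ) + 1 + (k + 1) = i + k + 1 + 1 by ring, show (i : ℕ) + (k + 1) = i + k + 1 by ring,
    show (i : ℕ) + 1 + k = i + k + 1 by ring]
  ring

theorem mulVec_mulSubMat_injective (c : ℝ) (N : ℕ) :
    Function.Injective (mulSubMat q c N).mulVec := by
  -- The left inverse is the quotient on division by X - c: X^i has quotient ∑_{m<i} c^{i-1-m} X^m.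
  have h : blockMat N (N + 1) (fun m i => if m < i then powSeq q c (i - 1 - m) else 0) *
      mulSubMat q c N = 1 := by
    ext ⟨m, x⟩ ⟨k, y⟩
    rw [mul_mulSubMat_apply]
    simp only [blockMat, Matrix.of_apply, Fin.val_succ, Fin.val_castSucc, Nat.add_sub_cancel]
    rcases lt_trichotomy (m : ℕ) k with hk | hk | hk
    · have h1 : m ≠ k := fun h => by simp [h] at hk
      have h2 : (k : ℕ) - m = (k - 1 - m) + 1 := by omega
      rw [if_pos (by omega), if_pos hk, h2]
      simp [powSeq, pow_succ', h1, mul_assoc]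
    · have h1 : m = k := Fin.ext hk
      subst h1
      simp [powSeq, Matrix.one_apply]
    · have h1 : m ≠ k := fun h => by simp [h] at hk
      rw [if_neg (by omega), if_neg (by omega)]
      simp [h1]
  intro v w hvw
  have := congrArg (Matrix.mulVec
    (blockMat N (N + 1) (fun m i => if m < i then powSeq q c (i - 1 - m) else 0))) hvw
  simpa only [Matrix.mulVec_mulVec, h, Matrix.one_mulVec] using this

/-- The weight (x - c)² arises by pulling the Hankel form back along the injective multiplication by
X - c, which costs one degree. -/
theorem posDef_hankel_leftSeq_leftSeq {t : ℕ → Matrix (Fin q) (Fin q) ℂ} {N : ℕ}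
    (h : (hankel t (N + 1)).PosDef) (c : ℝ) : (hankel (leftSeq c (leftSeq c t)) N).PosDef := by
  rw [← conjTranspose_mulSubMat_mul_hankel_mul]
  exact h.conjTranspose_mul_mul_same (mulVec_mulSubMat_injective c N)

/-- It is applied to the weight identities (b - a)(x - a) = (x - a)² + (x - a)(b - x), (b - a)(b -
x) = (x - b)² + (x - a)(b - x), b - a = (b - x) + (x - a), (b - a)(x - a)(b - x) = (x - a)²(b - x) +
(x - b)²(x - a). -/
theorem posDef_hankel_of_smul_eq_add {t u v : ℕ → Matrix (Fin q) (Fin q) ℂ} {N : ℕ} {c : ℝ}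
    (hc : 0 < c) (h : ∀ k, (c : ℂ) • t k = u k + v k) (hu : (hankel u N).PosDef)
    (hv : (hankel v N).PosDef) : (hankel t N).PosDef := by
  have h1 : hankel t N = (c⁻¹ : ℝ) • (hankel u N + hankel v N) := by
    ext ⟨i, x⟩ ⟨k, y⟩
    have h2 := congrFun (congrFun (h (i + k)) x) y
    have hc' : (c : ℂ) ≠ 0 := by exact_mod_cast hc.ne'
    simp only [hankel, blockMat, Matrix.smul_apply, Matrix.add_apply, Matrix.of_apply] at h2 ⊢
    rw [← h2, smul_eq_mul, Complex.real_smul]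
    push_cast
    field_simp
  rw [h1]
  exact (hu.add hv).smul (inv_pos.2 hc)

section

variable {a b : ℝ} {s : ℕ → Matrix (Fin q) (Fin q) ℂ} {N : ℕ}

theorem posDef_K2_of_even (hab : a < b) (h1 : (H1 s (N + 1)).PosDef) (h2 : (H2 a b s N).PosDef) :
    (K2 a s N).PosDef :=
  posDef_hankel_of_smul_eq_add (sub_pos.2 hab)
    (fun k => by simp only [leftSeq, hatSeq]; push_cast; module)
    (posDef_hankel_leftSeq_leftSeq h1 a) h2

theorem posDef_K1_of_even (hab : a < b) (h1 : (H1 s (N + 1)).PosDef) (h2 : (H2 a b s N).PosDef) :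
    (K1 b s N).PosDef :=
  posDef_hankel_of_smul_eq_add (sub_pos.2 hab)
    (fun k => by simp only [leftSeq, rightSeq, hatSeq]; push_cast; module)
    (posDef_hankel_leftSeq_leftSeq h1 b) h2

theorem posDef_H1_of_odd (hab : a < b) (h1 : (K1 b s N).PosDef) (h2 : (K2 a s N).PosDef) :
    (H1 s N).PosDef :=
  posDef_hankel_of_smul_eq_add (sub_pos.2 hab)
    (fun k => by simp only [leftSeq, rightSeq]; push_cast; module) h1 h2

theorem posDef_H2_of_odd (hab : a < b) (h1 : (K1 b s (N + 1)).PosDef)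
    (h2 : (K2 a s (N + 1)).PosDef) : (H2 a b s N).PosDef :=
  posDef_hankel_of_smul_eq_add (sub_pos.2 hab)
    (fun k => by simp only [leftSeq, rightSeq, hatSeq]; push_cast; module)
    (posDef_hankel_leftSeq_leftSeq h1 a) (posDef_hankel_leftSeq_leftSeq h2 b)

end

end THMM
end

/-! ### Normalization at a, and manipulation of ordered products -/

noncomputable section

namespace THMM

open Polynomial

variable {q : ℕ}

theorem IsOrth.inv_mul_apply_monicPoly {t : ℕ → Matrix (Fin q) (Fin q) ℂ} {N : ℕ}
    {F : MatPoly q} (ht : IsUnit (hankel t N))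
    (hs : ∀ k < 2 * N, (t k)ᴴ = t k) (h : IsOrth t N F)
    (hF : F ∈ degreeLT (Matrix (Fin q) (Fin q) ℂ) (N + 1))
    (φ ψ : MatPoly q →ₗ[Matrix (Fin q) (Fin q) ℂ] Matrix (Fin q) (Fin q) ℂ)
    (hφ : φ F = 1) : (φ (monicPoly t N))⁻¹ * ψ (monicPoly t N) = ψ F := by
  rw [← smul_eq_mul, ← map_smul, h.eq_inv_smul_monicPoly ht hs hF φ hφ]

theorem starConj_mul_inv_conjTranspose (F : ℂ → Matrix (Fin q) (Fin q) ℂ)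
    (A : Matrix (Fin q) (Fin q) ℂ) (z : ℂ) :
    starConj F z * (Aᴴ)⁻¹ = starConj (fun w => A⁻¹ * F w) z := by
  rw [starConj, starConj, Matrix.conjTranspose_mul, Matrix.conjTranspose_nonsing_inv]

theorem conjTranspose_mul_inv_conjTranspose (A B : Matrix (Fin q) (Fin q) ℂ) :
    Bᴴ * (Aᴴ)⁻¹ = (A⁻¹ * B)ᴴ := by
  rw [Matrix.conjTranspose_mul, Matrix.conjTranspose_nonsing_inv]

section Normalization

variable {a b : ℝ} {s : ℕ → Matrix (Fin q) (Fin q) ℂ} {N : ℕ}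

theorem isUnit_P1 (ht : IsUnit (hankel s N)) (hl : IsUnit (hankel (leftSeq a s) N))
    (hs : ∀ k < 2 * N, (s k)ᴴ = s k) : IsUnit (P1 s N a) := by
  rw [P1_eq]
  exact (isOrth_unitPoly hl fun k hk => hs k (by omega)).isUnit_apply_monicPoly ht hs
    (unitPoly_mem_degreeLT a s N) _ (momentPair_powSeq_unitPoly a s N)

/-- Left division by the value at a replaces the monic polynomial by the normalized one. As ψ is
arbitrary, numerators of the first and second kind are treated together. -/
theorem inv_P1_mul (ht : IsUnit (hankel s N)) (hl : IsUnit (hankel (leftSeq a s) N))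
    (hs : ∀ k < 2 * N, (s k)ᴴ = s k)
    (ψ : MatPoly q →ₗ[Matrix (Fin q) (Fin q) ℂ] Matrix (Fin q) (Fin q) ℂ) :
    (P1 s N a)⁻¹ * ψ (monicPoly s N) = ψ (unitPoly a s N) := by
  rw [P1_eq]
  exact (isOrth_unitPoly hl fun k hk => hs k (by omega)).inv_mul_apply_monicPoly ht hs
    (unitPoly_mem_degreeLT a s N) _ ψ (momentPair_powSeq_unitPoly a s N)

theorem Theta2_at (a : ℝ) (s : ℕ → Matrix (Fin q) (Fin q) ℂ) (N : ℕ) :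
    Theta2 a s N a = -momentPair s (monicPoly (leftSeq a s) N) := by
  rw [Theta2_eq, momentPair_divDiffSeq_mulSub, sub_self, zero_smul, zero_add]

theorem momentPair_rightSeq_zero (b : ℝ) (s : ℕ → Matrix (Fin q) (Fin q) ℂ)
    (F : MatPoly q) :
    momentPair (rightSeq b s) F = -momentPair s (mulSub b F) :=
  momentPair_rightSeq b s 0 F

theorem Q2_at (a b : ℝ) (s : ℕ → Matrix (Fin q) (Fin q) ℂ) (N : ℕ) :
    Q2 a b s N a = momentPair (rightSeq b s) (monicPoly (hatSeq a b s) N) := by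
  rw [Q2_eq, mulSub_comm, momentPair_divDiffSeq_mulSub, sub_self, zero_smul, zero_add,
    momentPair_rightSeq_zero]

theorem isUnit_momentPair_monicPoly_leftSeq (ht : IsUnit (hankel s (N + 1)))
    (hl : IsUnit (hankel (leftSeq a s) N)) (hs : ∀ k < 2 * N + 1, (s k)ᴴ = s k) :
    IsUnit (momentPair s (monicPoly (leftSeq a s) N)) :=
  (isOrth_kernelPoly ht).isUnit_apply_monicPoly hl
    (fun k hk => conjTranspose_leftSeq (hs k (by omega)) (hs (k + 1) (by omega)))
    (kernelPoly_mem_degreeLT a s _) _ (momentPair_kernelPoly ht)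

theorem inv_momentPair_monicPoly_leftSeq_mul (ht : IsUnit (hankel s (N + 1)))
    (hl : IsUnit (hankel (leftSeq a s) N)) (hs : ∀ k < 2 * N + 1, (s k)ᴴ = s k)
    (ψ : MatPoly q →ₗ[Matrix (Fin q) (Fin q) ℂ] Matrix (Fin q) (Fin q) ℂ) :
    (momentPair s (monicPoly (leftSeq a s) N))⁻¹ * ψ (monicPoly (leftSeq a s) N) =
      ψ (kernelPoly a s (N + 1)) :=
  (isOrth_kernelPoly ht).inv_mul_apply_monicPoly hl
    (fun k hk => conjTranspose_leftSeq (hs k (by omega)) (hs (k + 1) (by omega)))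
    (kernelPoly_mem_degreeLT a s _) _ ψ (momentPair_kernelPoly ht)

theorem inv_neg_matrix (A : Matrix (Fin q) (Fin q) ℂ) : (-A)⁻¹ = -A⁻¹ := by
  by_cases h : IsUnit A.det
  · exact Matrix.inv_eq_left_inv (by rw [neg_mul_neg, Matrix.nonsing_inv_mul _ h])
  · have h' : ¬ IsUnit (-A).det := by
      rwa [← Matrix.isUnit_iff_isUnit_det, IsUnit.neg_iff, Matrix.isUnit_iff_isUnit_det]
    rw [Matrix.nonsing_inv_apply_not_isUnit _ h, Matrix.nonsing_inv_apply_not_isUnit _ h', neg_zero]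

end Normalization

section Products

/-- Regrouping detaches the first upper factor, with parameter l_{-1} = s_0, and leaves the
lower–upper product belonging to s^{(1)}. -/
theorem rightProd_succ_mul (N : ℕ) (A B : ℕ → Matrix (Fin q ⊕ Fin q) (Fin q ⊕ Fin q) ℂ) :
    rightProd N (fun k => A k * B k) * A N = A 0 * rightProd N (fun k => B k * A (k + 1)) := by
  induction N with
  | zero => rw [rightProd_zero, rightProd_zero, one_mul, mul_one]
  | succ N ih =>
    rw [rightProd_succ, rightProd_succ, ← mul_assoc, ih]
    simp only [mul_assoc]

theorem rightProd_conj (N : ℕ) (A : ℕ → Matrix (Fin q ⊕ Fin q) (Fin q ⊕ Fin q) ℂ)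
    {D D' : Matrix (Fin q ⊕ Fin q) (Fin q ⊕ Fin q) ℂ} (h : D' * D = 1) :
    rightProd N (fun k => D * A k * D') = D * rightProd N A * D' := by
  induction N with
  | zero => rw [rightProd_zero, rightProd_zero, mul_one, mul_eq_one_comm.1 h]
  | succ N ih =>
    rw [rightProd_succ, rightProd_succ, ih]
    simp only [mul_assoc]
    rw [← mul_assoc D' D, h, one_mul]

theorem scalDiag_mul_scalDiag (c d c' d' : ℂ) :
    scalDiag q c d * scalDiag q c' d' = scalDiag q (c * c') (d * d') := by
  simp [scalDiag, Matrix.fromBlocks_multiply, smul_smul, mul_comm]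

theorem scalDiag_one : scalDiag q 1 1 = 1 := by
  simp [scalDiag]

/-- With the next lemma, conjugation by diag(c, 1) moves a scalar c = z - a from the lower factors
to the upper ones. -/
theorem upper_smul (X : Matrix (Fin q) (Fin q) ℂ) {c : ℂ} (hc : c ≠ 0) :
    upper (c • X) = scalDiag q c 1 * upper X * scalDiag q (1 / c) 1 := by
  simp [upper, scalDiag, Matrix.fromBlocks_multiply, smul_smul, hc]

theorem lower_eq_scalDiag_conj (X : Matrix (Fin q) (Fin q) ℂ) {c : ℂ} (hc : c ≠ 0) :
    lower X = scalDiag q c 1 * lower (c • X) * scalDiag q (1 / c) 1 := by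
  simp [lower, scalDiag, Matrix.fromBlocks_multiply, smul_smul, hc]

theorem scalDiag_conj_lower (X : Matrix (Fin q) (Fin q) ℂ) {c : ℂ} (hc : c ≠ 0) (d e : ℂ) :
    scalDiag q (1 / c) 1 * lower X * scalDiag q (d * c) e =
      lower (c • X) * scalDiag q d e := by
  simp [lower, scalDiag, Matrix.fromBlocks_multiply, smul_smul, mul_comm]
  rw [mul_right_comm, mul_inv_cancel₀ hc, one_mul]

end Products

section Transform

variable {a b : ℝ} {s : ℕ → Matrix (Fin q) (Fin q) ℂ}

theorem starConj_mulSub_powSeq (c : ℝ) (F : MatPoly q) (z : ℂ) :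
    starConj (fun w => momentPair (powSeq q w) (mulSub c F)) z =
      (z - c) • starConj (fun w => momentPair (powSeq q w) F) z := by
  simp [starConj, momentPair_powSeq_mulSub, Matrix.conjTranspose_smul]

theorem starConj_mulSub_divDiffSeq (c : ℝ) (t : ℕ → Matrix (Fin q) (Fin q) ℂ)
    (F : MatPoly q) (z : ℂ) :
    starConj (fun w => momentPair (divDiffSeq t w) (mulSub c F)) z =
      (z - c) • starConj (fun w => momentPair (divDiffSeq t w) F) z + (momentPair t F)ᴴ := by
  simp [starConj, momentPair_divDiffSeq_mulSub, Matrix.conjTranspose_smul]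

theorem starConj_neg (F : ℂ → Matrix (Fin q) (Fin q) ℂ) (z : ℂ) :
    starConj (fun w => -F w) z = -starConj F z := by
  simp [starConj]

theorem starConj_real_smul (c : ℝ) (F : ℂ → Matrix (Fin q) (Fin q) ℂ) (z : ℂ) :
    starConj (fun w => (c : ℂ) • F w) z = (c : ℂ) • starConj F z := by
  simp [starConj, Matrix.conjTranspose_smul]

/-- Passage from the measure `(b - x) dσ` to the measure `dσ`. -/
theorem upper_mul_pairMat_rightSeq (hs : (s 0)ᴴ = s 0) (F G : MatPoly q)
    (z : ℂ) :
    upper (s 0) * pairMat a (rightSeq b s) F G z =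
      Matrix.fromBlocks
        (1 - (z - a) • starConj (fun w => momentPair (divDiffSeq s w) (mulSub b F)) z)
        (starConj (fun w => momentPair (divDiffSeq s w) (mulSub b G)) z)
        (-((z - a) • starConj (fun w => momentPair (powSeq q w) F) z))
        (starConj (fun w => momentPair (powSeq q w) G) z) := by
  simp only [pairMat, upper, Matrix.fromBlocks_multiply, momentPair_divDiffSeq_rightSeq, starConj,
    Matrix.conjTranspose_add, Matrix.conjTranspose_neg, Matrix.conjTranspose_mul, hs, one_mul,
    zero_mul, zero_add, mul_neg, mul_smul_comm, smul_add, smul_neg, neg_add, neg_neg]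
  congr 1 <;> abel

end Transform

end THMM
end

/-! ### Resolvent matrices as pairs of normalized polynomials -/

noncomputable section

namespace THMM

open Polynomial

variable {q : ℕ} {a b : ℝ} {s : ℕ → Matrix (Fin q) (Fin q) ℂ} {n : ℕ}

section Ratios

theorem inv_Gamma1_mul (hr : IsUnit (hankel (rightSeq b s) n))
    (hh : IsUnit (hankel (hatSeq a b s) n)) (hs : ∀ k < 2 * n + 1, (s k)ᴴ = s k)
    (ψ : MatPoly q →ₗ[Matrix (Fin q) (Fin q) ℂ] Matrix (Fin q) (Fin q) ℂ) :
    (Gamma1 b s n a)⁻¹ * ψ (monicPoly (rightSeq b s) n) = ψ (unitPoly a (rightSeq b s) n) :=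
  inv_P1_mul hr (by rwa [leftSeq_rightSeq])
    (fun k hk => conjTranspose_rightSeq (hs k (by omega)) (hs (k + 1) (by omega))) ψ

theorem isUnit_Gamma1 (hr : IsUnit (hankel (rightSeq b s) n))
    (hh : IsUnit (hankel (hatSeq a b s) n)) (hs : ∀ k < 2 * n + 1, (s k)ᴴ = s k) :
    IsUnit (Gamma1 b s n a) :=
  isUnit_P1 hr (by rwa [leftSeq_rightSeq])
    (fun k hk => conjTranspose_rightSeq (hs k (by omega)) (hs (k + 1) (by omega)))

theorem isUnit_Theta2 (ht : IsUnit (hankel s (n + 1))) (hl : IsUnit (hankel (leftSeq a s) n))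
    (hs : ∀ k < 2 * n + 1, (s k)ᴴ = s k) : IsUnit (Theta2 a s n a) := by
  rw [Theta2_at]
  exact (isUnit_momentPair_monicPoly_leftSeq ht hl hs).neg

theorem inv_Theta2_mul (ht : IsUnit (hankel s (n + 1))) (hl : IsUnit (hankel (leftSeq a s) n))
    (hs : ∀ k < 2 * n + 1, (s k)ᴴ = s k)
    (ψ : MatPoly q →ₗ[Matrix (Fin q) (Fin q) ℂ] Matrix (Fin q) (Fin q) ℂ) :
    (Theta2 a s n a)⁻¹ * ψ (monicPoly (leftSeq a s) n) = -ψ (kernelPoly a s (n + 1)) := by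
  rw [Theta2_at, inv_neg_matrix, neg_mul, inv_momentPair_monicPoly_leftSeq_mul ht hl hs]

/-- Since ŝ is the weight x - a applied to s^{(1)}, and Q_2(a) is the s^{(1)}-integral of the monic
polynomial, this is the case of Θ_2 up to sign, with s^{(1)} in place of s. -/
theorem isUnit_Q2 (hr : IsUnit (hankel (rightSeq b s) (n + 1)))
    (hh : IsUnit (hankel (hatSeq a b s) n)) (hs : ∀ k < 2 * n + 2, (s k)ᴴ = s k) :
    IsUnit (Q2 a b s n a) := by
  rw [Q2_at, ← leftSeq_rightSeq]
  exact isUnit_momentPair_monicPoly_leftSeq hr (by rwa [leftSeq_rightSeq])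
    (fun k hk => conjTranspose_rightSeq (hs k (by omega)) (hs (k + 1) (by omega)))

theorem inv_Q2_mul (hr : IsUnit (hankel (rightSeq b s) (n + 1)))
    (hh : IsUnit (hankel (hatSeq a b s) n)) (hs : ∀ k < 2 * n + 2, (s k)ᴴ = s k)
    (ψ : MatPoly q →ₗ[Matrix (Fin q) (Fin q) ℂ] Matrix (Fin q) (Fin q) ℂ) :
    (Q2 a b s n a)⁻¹ * ψ (monicPoly (hatSeq a b s) n) =
      ψ (kernelPoly a (rightSeq b s) (n + 1)) := by
  rw [Q2_at, ← leftSeq_rightSeq]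
  exact inv_momentPair_monicPoly_leftSeq_mul hr (by rwa [leftSeq_rightSeq])
    (fun k hk => conjTranspose_rightSeq (hs k (by omega)) (hs (k + 1) (by omega))) ψ

end Ratios

theorem resolventEven_eq_pairMat (ht : IsUnit (hankel s (n + 1)))
    (hl : IsUnit (hankel (leftSeq a s) n)) (hr : IsUnit (hankel (rightSeq b s) n))
    (hh : IsUnit (hankel (hatSeq a b s) n)) (hs : ∀ k < 2 * n + 1, (s k)ᴴ = s k) (z : ℂ) :
    resolventEven a b s n z = pairMat a s (kernelPoly a s (n + 1))
      (((-(1 / (b - a)) : ℝ) : ℂ) • mulSub b (unitPoly a (rightSeq b s) n)) z := by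
  have h1 (w : ℂ) : (Theta2 a s n a)⁻¹ * Theta2 a s n w =
      momentPair (divDiffSeq s w) (mulSub a (kernelPoly a s (n + 1))) := by
    rw [Theta2_eq (z := w), mul_neg, ← LinearMap.comp_apply, inv_Theta2_mul ht hl hs, neg_neg]
    rfl
  have h2 (w : ℂ) : (Theta2 a s n a)⁻¹ * Gamma2 a s n w =
      -momentPair (powSeq q w) (kernelPoly a s (n + 1)) := by
    rw [Gamma2_eq, inv_Theta2_mul ht hl hs]
  have h3 (w : ℂ) : (Gamma1 b s n a)⁻¹ * Gamma1 b s n w =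
      momentPair (powSeq q w) (unitPoly a (rightSeq b s) n) := by
    rw [Gamma1_eq (z := w), inv_Gamma1_mul hr hh hs]
  have h4 (w : ℂ) : (Gamma1 b s n a)⁻¹ * Theta1 b s n w =
      momentPair (divDiffSeq s w) (mulSub b (unitPoly a (rightSeq b s) n)) := by
    rw [Theta1_eq, ← LinearMap.comp_apply, inv_Gamma1_mul hr hh hs]
    rfl
  simp only [resolventEven, pairMat, starConj_mul_inv_conjTranspose, h1, h2, h3, h4,
    momentPair_csmul, starConj_real_smul, starConj_mulSub_powSeq, starConj_neg, smul_neg]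
  -- The upper left block is the divided difference of (x - a)K_{n+1}, that is 1 + (z - a)E_z
  -- K_{n+1} because the kernel has integral 1.
  rw [starConj_mulSub_divDiffSeq, momentPair_kernelPoly ht, Matrix.conjTranspose_one]
  congr 1
  · abel
  · push_cast
    module
  · rw [smul_smul]
    congr 1
    push_cast
    ring

theorem momentPair_neg_mulSub_kernelPoly (hr : IsUnit (hankel (rightSeq b s) (n + 1))) :
    momentPair s (-mulSub b (kernelPoly a (rightSeq b s) (n + 1))) = 1 := by
  rw [map_neg, ← momentPair_rightSeq_zero, momentPair_kernelPoly hr]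

theorem resolventOdd_eq_pairMat (ht : IsUnit (hankel s (n + 1)))
    (hl : IsUnit (hankel (leftSeq a s) (n + 1))) (hr : IsUnit (hankel (rightSeq b s) (n + 1)))
    (hh : IsUnit (hankel (hatSeq a b s) n)) (hs : ∀ k < 2 * n + 2, (s k)ᴴ = s k) (z : ℂ) :
    resolventOdd a b s n z = pairMat a s (-mulSub b (kernelPoly a (rightSeq b s) (n + 1)))
      (unitPoly a s (n + 1)) z := by
  have h1 (w : ℂ) : (Q2 a b s n a)⁻¹ * Q2 a b s n w =
      momentPair (divDiffSeq s w) (mulSub a (-mulSub b (kernelPoly a (rightSeq b s) (n + 1)))) := by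
    rw [Q2_eq (z := w), mul_neg, ← LinearMap.comp_apply, ← LinearMap.comp_apply,
      inv_Q2_mul hr hh hs, map_neg, map_neg, mulSub_comm]
    rfl
  have h2 (w : ℂ) : (Q2 a b s n a)⁻¹ * P2 a b s n w =
      momentPair (powSeq q w) (kernelPoly a (rightSeq b s) (n + 1)) := by
    rw [P2_eq, inv_Q2_mul hr hh hs]
  have h3 (w : ℂ) : (P1 s (n + 1) a)⁻¹ * P1 s (n + 1) w =
      momentPair (powSeq q w) (unitPoly a s (n + 1)) := by
    rw [P1_eq (z := w), inv_P1_mul ht hl hs]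
  have h4 (w : ℂ) : (P1 s (n + 1) a)⁻¹ * Q1 s (n + 1) w =
      momentPair (divDiffSeq s w) (unitPoly a s (n + 1)) := by
    rw [Q1_eq, inv_P1_mul ht hl hs]
  have h5 : starConj (fun w => momentPair (powSeq q w)
      (-mulSub b (kernelPoly a (rightSeq b s) (n + 1)))) z =
      (b - z) • starConj (fun w => momentPair (powSeq q w)
        (kernelPoly a (rightSeq b s) (n + 1))) z := by
    simp only [map_neg, starConj_neg, starConj_mulSub_powSeq]
    module
  simp only [resolventOdd, pairMat, starConj_mul_inv_conjTranspose, h1, h2, h3, h4, h5, smul_smul]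
  rw [starConj_mulSub_divDiffSeq, momentPair_neg_mulSub_kernelPoly hr, Matrix.conjTranspose_one,
    add_comm]

/-! ### Connection formulas between the weights 1 and b - x -/

section Identities

/-- The left side and U_n for s both have value 1 at a and are orthogonal to x^k, k < n. Their
difference is thus (x - a)h with h orthogonal for the weight x - a, hence h is a multiple of
K_{n+1}. -/
theorem mulSub_unitPoly_eq (hab : a < b) (ht : IsUnit (hankel s (n + 1)))
    (hl : IsUnit (hankel (leftSeq a s) n))
    (hh : IsUnit (hankel (hatSeq a b s) n)) (hs : ∀ k < 2 * n + 1, (s k)ᴴ = s k) :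
    ((-(1 / (b - a)) : ℝ) : ℂ) • mulSub b (unitPoly a (rightSeq b s) n) =
      unitPoly a s n - (momentPair (divDiffSeq s a) (unitPoly a s n) +
        ((1 / (b - a) : ℝ) : ℂ) • momentPair (divDiffSeq s a)
          (mulSub b (unitPoly a (rightSeq b s) n))) • mulSub a (kernelPoly a s (n + 1)) := by
  set c : ℂ := ((1 / (b - a) : ℝ) : ℂ) with hc
  have hba : ((b : ℂ) - a) ≠ 0 := by exact_mod_cast (sub_pos.2 hab).ne'
  have hc1 : c * (b - a) = 1 := by rw [hc]; push_cast; field_simp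
  have hneg : ((-(1 / (b - a)) : ℝ) : ℂ) = -c := by rw [hc]; push_cast; ring
  rw [hneg]
  -- The explicit quotient by x - a; the constant terms combine through c(b - a) = 1.
  set h : MatPoly q :=
    c • (mulSub b (markovPoly a (rightSeq b s) n) - 1) + markovPoly a s n with hh0
  have h1 : mulSub a h = (-c) • mulSub b (unitPoly a (rightSeq b s) n) - unitPoly a s n := by
    have e1 : (1 : MatPoly q) = c • ((b : ℂ) - a) • 1 := by
      rw [smul_smul, hc1, one_smul]
    have e2 := mulSub_eq_add (a : ℂ) b (1 : MatPoly q)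
    rw [hh0, unitPoly, unitPoly, map_add, mulSub_csmul, map_sub, map_sub, mulSub_comm (b : ℂ) a, e2]
    conv_rhs => rw [← sub_add, e1]
    simp only [smul_sub, neg_smul, smul_add]
    rw [← e1]
    abel
  have h2 : IsOrth (leftSeq a s) n h := by
    intro k hk
    have e1 := isOrth_unitPoly (a := a) (t := rightSeq b s) (N := n) (by rwa [leftSeq_rightSeq])
      (fun k hk => conjTranspose_rightSeq (hs k (by omega)) (hs (k + 1) (by omega))) k hk
    rw [momentPair_rightSeq, neg_eq_zero] at e1
    rw [momentPair_leftSeq, h1, map_sub, momentPair_csmul, e1, smul_zero,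
      isOrth_unitPoly hl (fun k hk => hs k (by omega)) k hk, sub_zero]
  have h3 : h ∈ degreeLT (Matrix (Fin q) (Fin q) ℂ) (n + 1) := by
    refine Submodule.add_mem _ ?_ (degreeLT_le_succ n (reprPoly_mem_degreeLT _ _ _))
    have e1 : mulSub b (markovPoly a (rightSeq b s) n) - 1 ∈
        degreeLT (Matrix (Fin q) (Fin q) ℂ) (n + 1) :=
      Submodule.sub_mem _ (mulSub_mem_degreeLT _ (reprPoly_mem_degreeLT _ _ _)) (one_mem_degreeLT n)
    exact Submodule.smul_of_tower_mem _ c e1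
  have h4 := h2.eq_apply_smul hl (fun k hk => conjTranspose_leftSeq (hs k (by omega))
    (hs (k + 1) (by omega))) h3 (isOrth_kernelPoly ht) (kernelPoly_mem_degreeLT a s _) _
    (momentPair_kernelPoly ht)
  have h5 : momentPair s h = -(momentPair (divDiffSeq s a) (unitPoly a s n) +
        c • momentPair (divDiffSeq s a) (mulSub b (unitPoly a (rightSeq b s) n))) := by
    have e1 := momentPair_divDiffSeq_mulSub s a a h
    rw [sub_self, zero_smul, zero_add, h1, map_sub, momentPair_csmul] at e1
    rw [← e1]
    module
  rw [h5] at h4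
  have h6 := congrArg (mulSub (a : ℂ)) h4
  rw [h1, map_smul, sub_eq_iff_eq_add'] at h6
  exact h6.trans (by rw [neg_smul _ (mulSub _ _), ← sub_eq_add_neg])

/-- Against (b - x)x^k, k < n, the kernel of s gives (b - a)a^k, just as b - a times the kernel of
s^{(1)} does. -/
theorem kernelPoly_eq_of_even (ht : IsUnit (hankel s (n + 1)))
    (hr : IsUnit (hankel (rightSeq b s) n))
    (hh : IsUnit (hankel (hatSeq a b s) n)) (hs : ∀ k < 2 * n + 1, (s k)ᴴ = s k) :
    kernelPoly a s (n + 1) = ((b : ℂ) - a) • kernelPoly a (rightSeq b s) n +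
      (momentPair (powSeq q a) (kernelPoly a s (n + 1)) -
        ((b : ℂ) - a) • momentPair (powSeq q a) (kernelPoly a (rightSeq b s) n)) •
        unitPoly a (rightSeq b s) n := by
  have hs' : ∀ k < 2 * n, (rightSeq b s k)ᴴ = rightSeq b s k :=
    fun k hk => conjTranspose_rightSeq (hs k (by omega)) (hs (k + 1) (by omega))
  rw [← momentPair_csmul, ← map_sub, ← sub_eq_iff_eq_add']
  refine IsOrth.eq_apply_smul hr hs' ?_ ?_
    (isOrth_unitPoly (by rwa [leftSeq_rightSeq]) fun k hk => hs' k (by omega))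
    (unitPoly_mem_degreeLT _ _ _) _ (momentPair_powSeq_unitPoly _ _ _)
  · intro k hk
    have e1 := momentPair_shift_kernelPoly (a := a) ht (show k < n + 1 by omega)
    have e2 := momentPair_shift_kernelPoly (a := a) ht (show k + 1 < n + 1 by omega)
    have e3 : (fun i => rightSeq b s (i + k)) =
        fun i => (b : ℂ) • s (i + k) + (-1 : ℂ) • s (i + (k + 1)) := by
      funext i
      rw [rightSeq, add_assoc, neg_one_smul, sub_eq_add_neg]
    rw [map_sub, momentPair_csmul, momentPair_shift_kernelPoly hr hk, e3, momentPair_add_seq,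
      momentPair_smul_seq, momentPair_smul_seq, e1, e2, powSeq, powSeq, pow_succ', mul_smul]
    module
  · exact Submodule.sub_mem _ (kernelPoly_mem_degreeLT _ _ _)
      (Submodule.smul_of_tower_mem _ _ (degreeLT_le_succ n (kernelPoly_mem_degreeLT _ _ _)))

/-- Orthogonality of U_{n+1} to x^k and x^{k+1} implies orthogonality for the weight b - x when k <
n. Both polynomials have value 1 at a, so the quotient of the difference by x - a is orthogonal for
ŝ. -/
theorem unitPoly_succ_eq (hr : IsUnit (hankel (rightSeq b s) (n + 1)))
    (hl : IsUnit (hankel (leftSeq a s) (n + 1)))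
    (hh : IsUnit (hankel (hatSeq a b s) n)) (hs : ∀ k < 2 * n + 2, (s k)ᴴ = s k) :
    unitPoly a s (n + 1) = unitPoly a (rightSeq b s) n -
      (-momentPair (divDiffSeq s a) (mulSub b (unitPoly a (rightSeq b s) n)) -
        ((b : ℂ) - a) • momentPair (divDiffSeq s a) (unitPoly a s (n + 1))) •
        mulSub a (kernelPoly a (rightSeq b s) (n + 1)) := by
  have hs' : ∀ k < 2 * n + 1, (rightSeq b s k)ᴴ = rightSeq b s k :=
    fun k hk => conjTranspose_rightSeq (hs k (by omega)) (hs (k + 1) (by omega))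
  have hh' : IsUnit (hankel (leftSeq a (rightSeq b s)) n) := by rwa [leftSeq_rightSeq]
  set h : MatPoly q :=
    markovPoly a (rightSeq b s) n - markovPoly a s (n + 1) with hh0
  have h1 : mulSub a h = unitPoly a s (n + 1) - unitPoly a (rightSeq b s) n := by
    rw [hh0, map_sub, unitPoly, unitPoly]
    abel
  have hu := isOrth_unitPoly hl fun k hk => hs k (by omega)
  have h2 : IsOrth (leftSeq a (rightSeq b s)) n h := by
    intro k hk
    have e3 : (fun i => rightSeq b s (i + k)) =
        fun i => (b : ℂ) • s (i + k) + (-1 : ℂ) • s (i + (k + 1)) := by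
      funext i
      rw [rightSeq, add_assoc, neg_one_smul, sub_eq_add_neg]
    rw [momentPair_leftSeq, h1, map_sub, isOrth_unitPoly hh' (fun k hk => hs' k (by omega)) k hk,
      e3, momentPair_add_seq, momentPair_smul_seq, momentPair_smul_seq, hu k (by omega),
      hu (k + 1) (by omega)]
    simp
  have h3 : h ∈ degreeLT (Matrix (Fin q) (Fin q) ℂ) (n + 1) :=
    Submodule.sub_mem _ (degreeLT_le_succ n (reprPoly_mem_degreeLT _ _ _))
      (reprPoly_mem_degreeLT _ _ _)
  have h4 := h2.eq_apply_smul hh' (fun k hk => conjTranspose_leftSeq (hs' k (by omega))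
    (hs' (k + 1) (by omega))) h3 (isOrth_kernelPoly hr) (kernelPoly_mem_degreeLT a _ _) _
    (momentPair_kernelPoly hr)
  have h5 : momentPair (rightSeq b s) h =
      -(-momentPair (divDiffSeq s a) (mulSub b (unitPoly a (rightSeq b s) n)) -
        ((b : ℂ) - a) • momentPair (divDiffSeq s a) (unitPoly a s (n + 1))) := by
    -- The integral of (x - b)h is the divided difference at a of (x - a)(x - b)h; the term ∫
    -- U_{n+1} dσ that appears vanishes by orthogonality.
    have e1 := momentPair_divDiffSeq_mulSub s a a (mulSub b h)
    rw [sub_self, zero_smul, zero_add, mulSub_comm, h1, map_sub, map_sub,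
      momentPair_divDiffSeq_mulSub _ _ _ (unitPoly a s (n + 1)),
      momentPair_unitPoly hl fun k hk => hs k (by omega)] at e1
    rw [momentPair_rightSeq_zero, ← e1]
    module
  rw [h5] at h4
  have h6 := congrArg (mulSub (a : ℂ)) h4
  rw [h1, map_smul, sub_eq_iff_eq_add'] at h6
  exact h6.trans (by rw [neg_smul _ (mulSub _ _), ← sub_eq_add_neg])

/-- Multiplied by b - x, the kernel of s^{(1)} reproduces a^k, k ≤ n, against s, as the kernel of s
does. -/
theorem neg_mulSub_kernelPoly_eq (ht : IsUnit (hankel s (n + 1)))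
    (hr : IsUnit (hankel (rightSeq b s) (n + 1))) (hl : IsUnit (hankel (leftSeq a s) (n + 1)))
    (hs : ∀ k < 2 * n + 2, (s k)ᴴ = s k) :
    -mulSub b (kernelPoly a (rightSeq b s) (n + 1)) = kernelPoly a s (n + 1) +
      (((b : ℂ) - a) • momentPair (powSeq q a) (kernelPoly a (rightSeq b s) (n + 1)) -
        momentPair (powSeq q a) (kernelPoly a s (n + 1))) • unitPoly a s (n + 1) := by
  have e : ((b : ℂ) - a) • momentPair (powSeq q a) (kernelPoly a (rightSeq b s) (n + 1)) =
      momentPair (powSeq q a) (-mulSub b (kernelPoly a (rightSeq b s) (n + 1))) := by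
    rw [map_neg, momentPair_powSeq_mulSub]
    module
  rw [e, ← map_sub, ← sub_eq_iff_eq_add']
  refine IsOrth.eq_apply_smul ht hs ?_ ?_ (isOrth_unitPoly hl fun k hk => hs k (by omega))
    (unitPoly_mem_degreeLT _ _ _) _ (momentPair_powSeq_unitPoly _ _ _)
  · intro k hk
    rw [map_sub, map_neg, ← momentPair_rightSeq, momentPair_shift_kernelPoly ht hk,
      momentPair_shift_kernelPoly hr hk, sub_self]
  · exact Submodule.sub_mem _ (Submodule.neg_mem _
      (mulSub_mem_degreeLT _ (kernelPoly_mem_degreeLT _ _ _)))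
      (degreeLT_le_succ _ (kernelPoly_mem_degreeLT _ _ _))

end Identities

end THMM
end

/-! ### The four factorizations -/

noncomputable section

namespace THMM

open Polynomial

variable {q : ℕ} {a b : ℝ} {s : ℕ → Matrix (Fin q) (Fin q) ℂ} {n : ℕ}

theorem inv_Theta2_mul_Gamma2 (ht : IsUnit (hankel s (n + 1)))
    (hl : IsUnit (hankel (leftSeq a s) n)) (hs : ∀ k < 2 * n + 1, (s k)ᴴ = s k) :
    (Theta2 a s n a)⁻¹ * Gamma2 a s n a =
      -momentPair (powSeq q a) (kernelPoly a s (n + 1)) := by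
  rw [Gamma2_eq, inv_Theta2_mul ht hl hs]

theorem inv_Q2_mul_P2 (hr : IsUnit (hankel (rightSeq b s) (n + 1)))
    (hh : IsUnit (hankel (hatSeq a b s) n)) (hs : ∀ k < 2 * n + 2, (s k)ᴴ = s k) :
    (Q2 a b s n a)⁻¹ * P2 a b s n a =
      momentPair (powSeq q a) (kernelPoly a (rightSeq b s) (n + 1)) := by
  rw [P2_eq, inv_Q2_mul hr hh hs]

theorem inv_Gamma1_mul_Theta1 (hr : IsUnit (hankel (rightSeq b s) n))
    (hh : IsUnit (hankel (hatSeq a b s) n)) (hs : ∀ k < 2 * n + 1, (s k)ᴴ = s k) :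
    (Gamma1 b s n a)⁻¹ * Theta1 b s n a =
      momentPair (divDiffSeq s a) (mulSub b (unitPoly a (rightSeq b s) n)) := by
  rw [Theta1_eq, ← LinearMap.comp_apply, inv_Gamma1_mul hr hh hs]
  rfl

theorem inv_P1_mul_Q1 (ht : IsUnit (hankel s n)) (hl : IsUnit (hankel (leftSeq a s) n))
    (hs : ∀ k < 2 * n, (s k)ᴴ = s k) :
    (P1 s n a)⁻¹ * Q1 s n a = momentPair (divDiffSeq s a) (unitPoly a s n) := by
  rw [Q1_eq, inv_P1_mul ht hl hs]

theorem rightProd_bigPar (ht : ∀ j ≤ n, (hankel s j).PosDef)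
    (hl : ∀ j ≤ n, (hankel (leftSeq a s) j).PosDef) (hs : ∀ k < 2 * n, (s k)ᴴ = s k) (z : ℂ) :
    rightProd n (fun k => lower (-((z - a) • bigMPar a s k)) * upper (bigLPar a s k)) =
      pairMat a s (kernelPoly a s n) (unitPoly a s n) z := by
  -- The formula for M_0 needs s_0 invertible, which the hypotheses give only for n ≥ 1; for n = 0
  -- both products are empty.
  rcases Nat.eq_zero_or_pos n with rfl | hn
  · rw [← rightProd_eq_pairMat ht hl hs, rightProd_zero, rightProd_zero]
  · simp only [bigMPar_eq (ht 1 hn).isUnit, bigLPar_eq]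
    exact rightProd_eq_pairMat ht hl hs z

theorem resolventEven_eq_bigPar (hab : a < b) (ht : ∀ j ≤ n + 1, (hankel s j).PosDef)
    (hl : ∀ j ≤ n, (hankel (leftSeq a s) j).PosDef) (hr : (hankel (rightSeq b s) n).PosDef)
    (hh : (hankel (hatSeq a b s) n).PosDef) (hs : ∀ k < 2 * n + 1, (s k)ᴴ = s k) (z : ℂ) :
    resolventEven a b s n z =
      rightProd n (fun k => lower (-((z - a) • bigMPar a s k)) * upper (bigLPar a s k)) *
      lower (-((z - a) • bigMPar a s n)) *
      upper ((Q1 s n a)ᴴ * ((P1 s n a)ᴴ)⁻¹ +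
        (1 / (b - a) : ℂ) • ((Theta1 b s n a)ᴴ * ((Gamma1 b s n a)ᴴ)⁻¹)) := by
  have h1 := (ht n (by omega)).isUnit
  have h2 := (ht (n + 1) le_rfl).isUnit
  have h3 := (hl n le_rfl).isUnit
  have hX : (Q1 s n a)ᴴ * ((P1 s n a)ᴴ)⁻¹ +
        (1 / (b - a) : ℂ) • ((Theta1 b s n a)ᴴ * ((Gamma1 b s n a)ᴴ)⁻¹) =
      (momentPair (divDiffSeq s a) (unitPoly a s n) +
        ((1 / (b - a) : ℝ) : ℂ) • momentPair (divDiffSeq s a)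
          (mulSub b (unitPoly a (rightSeq b s) n)))ᴴ := by
    rw [conjTranspose_mul_inv_conjTranspose, conjTranspose_mul_inv_conjTranspose,
      inv_Gamma1_mul_Theta1 hr.isUnit hh.isUnit hs,
      inv_P1_mul_Q1 h1 h3 (fun k hk => hs k (by omega)), Matrix.conjTranspose_add,
      Matrix.conjTranspose_smul]
    simp
  rw [hX, rightProd_bigPar (fun j hj => ht j (by omega)) hl (fun k hk => hs k (by omega)),
    bigMPar_eq (ht 1 (by omega)).isUnit,
    pairMat_mul_lower_kernelPoly (ht n (by omega)) (ht _ le_rfl) (hl _ le_rfl)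
      (fun k hk => hs k (by omega)),
    pairMat_mul_upper a (momentPair_kernelPoly h2), ← mulSub_unitPoly_eq hab h2 h3 hh.isUnit hs,
    resolventEven_eq_pairMat h2 h3 hr.isUnit hh.isUnit hs]

theorem resolventOdd_eq_bigPar (ht : ∀ j ≤ n + 1, (hankel s j).PosDef)
    (hl : ∀ j ≤ n + 1, (hankel (leftSeq a s) j).PosDef)
    (hr : (hankel (rightSeq b s) (n + 1)).PosDef)
    (hh : (hankel (hatSeq a b s) n).PosDef) (hs : ∀ k < 2 * n + 2, (s k)ᴴ = s k) {z : ℂ}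
    (hz : z ≠ a) :
    resolventOdd a b s n z =
      scalDiag q (1 / (z - a)) 1 *
      rightProd (n + 1)
        (fun k => lower (-bigMPar a s k) * upper ((z - a) • bigLPar a s k)) *
      lower (-((Gamma2 a s n a)ᴴ * ((Theta2 a s n a)ᴴ)⁻¹) -
        (b - a : ℂ) • ((P2 a b s n a)ᴴ * ((Q2 a b s n a)ᴴ)⁻¹)) *
      scalDiag q (z - a) 1 := by
  have hc : z - a ≠ 0 := sub_ne_zero.2 hz
  have h1 := (ht (n + 1) le_rfl).isUnit
  have h2 := (hl (n + 1) le_rfl).isUnit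
  have hD : scalDiag q (1 / (z - a)) 1 * scalDiag q (z - a) 1 = 1 := by
    rw [scalDiag_mul_scalDiag, one_div_mul_cancel hc, one_mul, scalDiag_one]
  have hprod : rightProd (n + 1)
        (fun k => lower (-bigMPar a s k) * upper ((z - a) • bigLPar a s k)) =
      scalDiag q (z - a) 1 * pairMat a s (kernelPoly a s (n + 1)) (unitPoly a s (n + 1)) z *
        scalDiag q (1 / (z - a)) 1 := by
    rw [← rightProd_bigPar ht hl hs, ← rightProd_conj _ _ hD]
    congr 1
    funext k
    rw [upper_smul _ hc, lower_eq_scalDiag_conj _ hc, smul_neg]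
    simp only [mul_assoc]
    rw [← mul_assoc (scalDiag q (1 / (z - a)) 1) (scalDiag q (z - a) 1), hD, one_mul]
  have hY : (z - a) • (-((Gamma2 a s n a)ᴴ * ((Theta2 a s n a)ᴴ)⁻¹) -
        (b - a : ℂ) • ((P2 a b s n a)ᴴ * ((Q2 a b s n a)ᴴ)⁻¹)) =
      -((z - a) • (((b : ℂ) - a) •
        momentPair (powSeq q a) (kernelPoly a (rightSeq b s) (n + 1)) -
        momentPair (powSeq q a) (kernelPoly a s (n + 1)))ᴴ) := by
    rw [conjTranspose_mul_inv_conjTranspose, conjTranspose_mul_inv_conjTranspose,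
      inv_Theta2_mul_Gamma2 h1 (hl n (by omega)).isUnit (fun k hk => hs k (by omega)),
      inv_Q2_mul_P2 hr.isUnit hh.isUnit hs, Matrix.conjTranspose_sub, Matrix.conjTranspose_smul,
      Matrix.conjTranspose_neg]
    simp only [star_sub, RCLike.star_def, Complex.conj_ofReal]
    module
  have hlow := scalDiag_conj_lower (-((Gamma2 a s n a)ᴴ * ((Theta2 a s n a)ᴴ)⁻¹) -
        (b - a : ℂ) • ((P2 a b s n a)ᴴ * ((Q2 a b s n a)ᴴ)⁻¹)) hc 1 1
  rw [one_mul, scalDiag_one, mul_one, hY] at hlow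
  rw [hprod]
  simp only [← mul_assoc]
  rw [hD, one_mul]
  simp only [mul_assoc]
  rw [← mul_assoc (scalDiag q (1 / (z - a)) 1), hlow, pairMat_mul_lower,
    ← neg_mulSub_kernelPoly_eq h1 hr.isUnit h2 hs,
    resolventOdd_eq_pairMat h1 h2 hr.isUnit hh.isUnit hs]

theorem rightProd_lPar_mul_upper (hr : ∀ j ≤ n, (hankel (rightSeq b s) j).PosDef)
    (hh : ∀ j ≤ n, (hankel (hatSeq a b s) j).PosDef) (hs : ∀ k < 2 * n + 1, (s k)ᴴ = s k) (z : ℂ) :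
    rightProd n (fun k => upper (lPar a b s k) * lower (-((z - a) • mPar a b s k))) *
        upper (lPar a b s n) =
      upper (s 0) * pairMat a (rightSeq b s) (kernelPoly a (rightSeq b s) n)
        (unitPoly a (rightSeq b s) n) z := by
  rw [rightProd_succ_mul n (fun k => upper (lPar a b s k))]
  simp only [mPar_eq, lPar_succ_eq a b (hs 0 (by omega))]
  rw [rightProd_eq_pairMat hr (fun j hj => by rw [leftSeq_rightSeq]; exact hh j hj)
    (fun k hk => conjTranspose_rightSeq (hs k (by omega)) (hs (k + 1) (by omega)))]
  rfl

theorem resolventOdd_eq_par (ht : (hankel s (n + 1)).PosDef)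
    (hl : (hankel (leftSeq a s) (n + 1)).PosDef)
    (hr : ∀ j ≤ n + 1, (hankel (rightSeq b s) j).PosDef)
    (hh : ∀ j ≤ n, (hankel (hatSeq a b s) j).PosDef) (hs : ∀ k < 2 * n + 2, (s k)ᴴ = s k) {z : ℂ}
    (hz : z ≠ b) :
    resolventOdd a b s n z =
      scalDiag q (1 / (b - z)) 1 *
      rightProd (n + 1) (fun k => upper (lPar a b s k) * lower (-((z - a) • mPar a b s k))) *
      upper (-((Gamma1 b s n a)⁻¹ * Theta1 b s n a) -
        (b - a : ℂ) • ((P1 s (n + 1) a)⁻¹ * Q1 s (n + 1) a)) *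
      scalDiag q (b - z) 1 := by
  have hc : (b : ℂ) - z ≠ 0 := sub_ne_zero.2 hz.symm
  have hrn := hr (n + 1) le_rfl
  have hhn := hh n le_rfl
  have hhn' : (hankel (leftSeq a (rightSeq b s)) n).PosDef := by rwa [leftSeq_rightSeq]
  have hs' : ∀ k < 2 * n + 1, (rightSeq b s k)ᴴ = rightSeq b s k :=
    fun k hk => conjTranspose_rightSeq (hs k (by omega)) (hs (k + 1) (by omega))
  set X : Matrix (Fin q) (Fin q) ℂ :=
    -momentPair (divDiffSeq s a) (mulSub b (unitPoly a (rightSeq b s) n)) -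
        ((b : ℂ) - a) • momentPair (divDiffSeq s a) (unitPoly a s (n + 1)) with hX
  have hXX : -((Gamma1 b s n a)⁻¹ * Theta1 b s n a) -
        (b - a : ℂ) • ((P1 s (n + 1) a)⁻¹ * Q1 s (n + 1) a) = X := by
    rw [inv_Gamma1_mul_Theta1 (hr n (by omega)).isUnit hhn.isUnit (fun k hk => hs k (by omega)),
      inv_P1_mul_Q1 ht.isUnit hl.isUnit hs]
  -- The last factor is stated without adjoints while `pairMat` produces them. X is a real
  -- combination of s_0 and the integrals of two Markov polynomials, all Hermitian.
  have hXh : Xᴴ = X := by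
    have e1 := momentPair_divDiffSeq_rightSeq b s a (unitPoly a (rightSeq b s) n)
    rw [momentPair_powSeq_unitPoly, momentPair_divDiffSeq_unitPoly, one_mul,
      ← sub_eq_iff_eq_add] at e1
    have e2 : (momentPair (rightSeq b s) (markovPoly a (rightSeq b s) n))ᴴ = _ :=
      isHermitian_momentPair_reprPoly hhn'.isHermitian _
    have e3 : (momentPair s (markovPoly a s (n + 1)))ᴴ = _ :=
      isHermitian_momentPair_reprPoly hl.isHermitian _
    rw [hX, ← e1, momentPair_divDiffSeq_unitPoly]
    simp only [Matrix.conjTranspose_sub, Matrix.conjTranspose_smul, Matrix.conjTranspose_neg, e2,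
      e3, hs 0 (by omega), star_sub, RCLike.star_def, Complex.conj_ofReal]
    rfl
  have h0 : momentPair s (unitPoly a s (n + 1)) = 0 :=
    momentPair_unitPoly hl.isUnit fun k hk => hs k (by omega)
  have hup := unitPoly_succ_eq hrn.isUnit hl.isUnit hhn.isUnit hs
  rw [hXX, ← hXh, rightProd_succ, ← mul_assoc (rightProd _ _),
    rightProd_lPar_mul_upper (fun j hj => hr j (by omega)) hh (fun k hk => hs k (by omega)), mPar_eq,
    mul_assoc (upper (s 0)),
    pairMat_mul_lower_kernelPoly (hr n (by omega)) hrn hhn' (fun k hk => hs' k (by omega)),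
    mul_assoc _ _ (upper _), mul_assoc (upper (s 0)), pairMat_mul_upper a
      (momentPair_kernelPoly hrn.isUnit), ← hup, upper_mul_pairMat_rightSeq (hs 0 (by omega)),
    resolventOdd_eq_pairMat ht.isUnit hl.isUnit hrn.isUnit hhn.isUnit hs]
  simp only [scalDiag, pairMat, Matrix.fromBlocks_multiply, map_neg, starConj_neg,
    starConj_mulSub_powSeq]
  -- As ∫ U_{n+1} dσ = 0, the divided difference of (x - b)U_{n+1} is (z - b) times that of U_{n+1},
  -- and the outer factor 1/(b - z) cancels.
  rw [starConj_mulSub_divDiffSeq b s (unitPoly a s (n + 1)), h0]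
  simp only [Matrix.conjTranspose_zero, add_zero, zero_add, Matrix.smul_mul, Matrix.mul_smul,
    Matrix.one_mul, Matrix.mul_one, Matrix.mul_zero, Matrix.zero_mul, one_smul, smul_zero,
    smul_smul, neg_zero, mul_neg, neg_mul, smul_neg]
  congr 1
  · match_scalars <;> field_simp
  · match_scalars
    field_simp
    ring
  · match_scalars
    ring

theorem resolventEven_eq_par (hab : a < b) (hn : 1 ≤ n) (ht : (hankel s (n + 1)).PosDef)
    (hl : (hankel (leftSeq a s) n).PosDef)
    (hr : ∀ j ≤ n, (hankel (rightSeq b s) j).PosDef)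
    (hh : ∀ j ≤ n, (hankel (hatSeq a b s) j).PosDef) (hs : ∀ k < 2 * n + 1, (s k)ᴴ = s k) {z : ℂ}
    (hza : z ≠ a) (hz : z ≠ b) :
    resolventEven a b s n z =
      scalDiag q (1 / ((b - z) * (z - a))) 1 *
      rightProd n (fun k => upper ((z - a) • lPar a b s k) * lower (-mPar a b s k)) *
      upper ((z - a) • lPar a b s n) *
      lower ((Q2 a b s (n - 1) a)⁻¹ * P2 a b s (n - 1) a +
        (1 / (b - a) : ℂ) • ((Theta2 a s n a)⁻¹ * Gamma2 a s n a)) *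
      scalDiag q ((b - a) * (z - a)) ((b - z) / (b - a)) := by
  have hc : z - a ≠ 0 := sub_ne_zero.2 hza
  have hd : (b : ℂ) - z ≠ 0 := sub_ne_zero.2 hz.symm
  have hba : ((b : ℂ) - a) ≠ 0 := by exact_mod_cast (sub_pos.2 hab).ne'
  have hrn := hr n le_rfl
  have hhn := hh n le_rfl
  have hD : scalDiag q (1 / (z - a)) 1 * scalDiag q (z - a) 1 = 1 := by
    rw [scalDiag_mul_scalDiag, one_div_mul_cancel hc, one_mul, scalDiag_one]
  have hprod : rightProd n (fun k => upper ((z - a) • lPar a b s k) * lower (-mPar a b s k)) *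
      upper ((z - a) • lPar a b s n) =
      scalDiag q (z - a) 1 * (upper (s 0) * pairMat a (rightSeq b s)
        (kernelPoly a (rightSeq b s) n) (unitPoly a (rightSeq b s) n) z) *
        scalDiag q (1 / (z - a)) 1 := by
    have e : (fun k => upper ((z - a) • lPar a b s k) * lower (-mPar a b s k)) = fun k =>
        scalDiag q (z - a) 1 * (upper (lPar a b s k) * lower (-((z - a) • mPar a b s k))) *
          scalDiag q (1 / (z - a)) 1 := by
      funext k
      rw [upper_smul _ hc, lower_eq_scalDiag_conj _ hc, smul_neg]
      simp only [mul_assoc]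
      rw [← mul_assoc (scalDiag q (1 / (z - a)) 1) (scalDiag q (z - a) 1), hD, one_mul]
    rw [← rightProd_lPar_mul_upper hr hh hs, e, rightProd_conj _ _ hD, upper_smul _ hc]
    simp only [mul_assoc]
    rw [← mul_assoc (scalDiag q (1 / (z - a)) 1) (scalDiag q (z - a) 1), hD, one_mul]
  set Y : Matrix (Fin q) (Fin q) ℂ :=
    momentPair (powSeq q a) (kernelPoly a (rightSeq b s) n) -
      (1 / (b - a) : ℂ) • momentPair (powSeq q a) (kernelPoly a s (n + 1)) with hY
  have hYY : (Q2 a b s (n - 1) a)⁻¹ * P2 a b s (n - 1) a +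
        (1 / (b - a) : ℂ) • ((Theta2 a s n a)⁻¹ * Gamma2 a s n a) = Y := by
    -- The polynomial of degree n - 1 behind Q_{2,n-1} normalizes to the kernel of degree < n.
    obtain ⟨m, rfl⟩ : ∃ m, n = m + 1 := ⟨n - 1, by omega⟩
    rw [inv_Theta2_mul_Gamma2 ht.isUnit hl.isUnit hs, Nat.add_sub_cancel,
      inv_Q2_mul_P2 hrn.isUnit (hh m (by omega)).isUnit (fun k hk => hs k (by omega)), hY, smul_neg,
      ← sub_eq_add_neg]
  have hYh : Yᴴ = Y := by
    have e1 : (momentPair (powSeq q a) (kernelPoly a (rightSeq b s) n))ᴴ = _ :=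
      isHermitian_momentPair_reprPoly hrn.isHermitian _
    have e2 : (momentPair (powSeq q a) (kernelPoly a s (n + 1)))ᴴ = _ :=
      isHermitian_momentPair_reprPoly ht.isHermitian _
    rw [hY, Matrix.conjTranspose_sub, Matrix.conjTranspose_smul, e1, e2]
    simp [kernelPoly]
  -- The last factor turns the kernel of s^{(1)} into that of s, divided by b - a; the outer
  -- diagonal entry b - a compensates.
  have hker : kernelPoly a (rightSeq b s) n + (-Y) • unitPoly a (rightSeq b s) n =
      (((1 / (b - a) : ℝ)) : ℂ) • kernelPoly a s (n + 1) := by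
    have e := kernelPoly_eq_of_even ht.isUnit hrn.isUnit hhn.isUnit hs
    have e1 : momentPair (powSeq q a) (kernelPoly a s (n + 1)) -
        ((b : ℂ) - a) • momentPair (powSeq q a) (kernelPoly a (rightSeq b s) n) =
        ((b : ℂ) - a) • (-Y) := by
      rw [hY, neg_sub, smul_sub, smul_smul, mul_one_div_cancel hba, one_smul]
    rw [e1, smul_assoc, ← smul_add] at e
    rw [e, smul_smul]
    push_cast
    rw [one_div_mul_cancel hba, one_smul]
  have hmid : scalDiag q (1 / (z - a)) 1 * lower Y *
      scalDiag q ((b - a) * (z - a)) ((b - z) / (b - a)) =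
      lower (-((z - a) • (-Y)ᴴ)) * scalDiag q (b - a) ((b - z) / (b - a)) := by
    rw [scalDiag_conj_lower Y hc, Matrix.conjTranspose_neg, hYh, smul_neg, neg_neg]
  have hleft : scalDiag q (1 / ((b - z) * (z - a))) 1 * scalDiag q (z - a) 1 =
      scalDiag q (1 / (b - z)) 1 := by
    rw [scalDiag_mul_scalDiag, one_mul]
    congr 1
    field_simp
  rw [hYY, mul_assoc (scalDiag q _ _) (rightProd _ _), hprod]
  simp only [← mul_assoc]
  rw [hleft]
  simp only [mul_assoc]
  rw [← mul_assoc (scalDiag q (1 / (z - a)) 1), hmid, ← mul_assoc (pairMat _ _ _ _ _),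
    pairMat_mul_lower, hker, ← mul_assoc (upper (s 0)), upper_mul_pairMat_rightSeq (hs 0 (by omega)),
    resolventEven_eq_pairMat ht.isUnit hl.isUnit hrn.isUnit hhn.isUnit hs]
  simp only [scalDiag, pairMat, Matrix.fromBlocks_multiply, mulSub_csmul, momentPair_csmul,
    starConj_real_smul, starConj_mulSub_powSeq]
  -- With ∫ K_{n+1} dσ = 1, the upper left block rests on 1 - (z - a)/(b - a) = (b - z)/(b - a).
  rw [starConj_mulSub_divDiffSeq b s (kernelPoly a s (n + 1)), momentPair_kernelPoly ht.isUnit]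
  simp only [Matrix.conjTranspose_one, add_zero, zero_add, Matrix.smul_mul, Matrix.mul_smul,
    Matrix.one_mul, Matrix.mul_one, Matrix.mul_zero, Matrix.zero_mul, one_smul, smul_zero,
    smul_smul, smul_add, smul_sub, mul_neg, neg_mul, Complex.ofReal_neg,
    Complex.ofReal_div, Complex.ofReal_one, Complex.ofReal_sub]
  congr 1
  · match_scalars <;> field_simp <;> ring
  · match_scalars; field_simp
  · match_scalars; field_simp
  · match_scalars; field_simp; ring

end THMM
end

/-! ### The theorem -/

theorem theorem5p3 {q : ℕ} (a b : ℝ) (hab : a < b) (s : ℕ → Matrix (Fin q) (Fin q) ℂ) (n : ℕ) :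
    -- the case of the moments `s_0, …, s_{2n}`
    (HausdorffPosDefEven a b s n →
      -- the matrices inverted in the definitions and in the formulas are invertible
      ((∀ j ≤ n, (H1 s (j + 1)).PosDef ∧ (H2 a b s j).PosDef ∧ (K1 b s j).PosDef ∧
          (K2 a s j).PosDef) ∧
        IsUnit (Theta2 a s n a) ∧ IsUnit (Gamma1 b s n a) ∧ IsUnit (P1 s n a) ∧
        (1 ≤ n → IsUnit (Q2 a b s (n - 1) a))) ∧
      -- part a)
      (1 ≤ n → ∀ z : ℂ, z ≠ a → z ≠ b →
        resolventEven a b s n z =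
          scalDiag q (1 / ((b - z) * (z - a))) 1 *
          rightProd n (fun k => upper ((z - a) • lPar a b s k) * lower (-mPar a b s k)) *
          upper ((z - a) • lPar a b s n) *
          lower ((Q2 a b s (n - 1) a)⁻¹ * P2 a b s (n - 1) a +
            (1 / (b - a) : ℂ) • ((Theta2 a s n a)⁻¹ * Gamma2 a s n a)) *
          scalDiag q ((b - a) * (z - a)) ((b - z) / (b - a))) ∧
      -- part b)
      (∀ z : ℂ,
        resolventEven a b s n z =
          rightProd n (fun k => lower (-((z - a) • bigMPar a s k)) * upper (bigLPar a s k)) *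
          lower (-((z - a) • bigMPar a s n)) *
          upper ((Q1 s n a)ᴴ * ((P1 s n a)ᴴ)⁻¹ +
            (1 / (b - a) : ℂ) • ((Theta1 b s n a)ᴴ * ((Gamma1 b s n a)ᴴ)⁻¹)))) ∧
    -- the case of the moments `s_0, …, s_{2n+1}`
    (HausdorffPosDefOdd a b s n →
      -- the matrices inverted in the definitions and in the formulas are invertible
      ((∀ j ≤ n, (H1 s (j + 1)).PosDef ∧ (H2 a b s j).PosDef ∧ (K1 b s (j + 1)).PosDef ∧
          (K2 a s (j + 1)).PosDef) ∧
        IsUnit (Q2 a b s n a) ∧ IsUnit (P1 s (n + 1) a) ∧ IsUnit (Gamma1 b s n a) ∧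
        IsUnit (Theta2 a s n a)) ∧
      -- part a)
      (∀ z : ℂ, z ≠ b →
        resolventOdd a b s n z =
          scalDiag q (1 / (b - z)) 1 *
          rightProd (n + 1) (fun k => upper (lPar a b s k) * lower (-((z - a) • mPar a b s k))) *
          upper (-((Gamma1 b s n a)⁻¹ * Theta1 b s n a) -
            (b - a : ℂ) • ((P1 s (n + 1) a)⁻¹ * Q1 s (n + 1) a)) *
          scalDiag q (b - z) 1) ∧
      -- part b)
      (∀ z : ℂ, z ≠ a →
        resolventOdd a b s n z =
          scalDiag q (1 / (z - a)) 1 *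
          rightProd (n + 1)
            (fun k => lower (-bigMPar a s k) * upper ((z - a) • bigLPar a s k)) *
          lower (-((Gamma2 a s n a)ᴴ * ((Theta2 a s n a)ᴴ)⁻¹) -
            (b - a : ℂ) • ((P2 a b s n a)ᴴ * ((Q2 a b s n a)ᴴ)⁻¹)) *
          scalDiag q (z - a) 1)) := by
  constructor
  · rintro ⟨h1, h2⟩
    have hk1 := posDef_K1_of_even hab h1 h2
    have hk2 := posDef_K2_of_even hab h1 h2
    have ht : ∀ j ≤ n + 1, (hankel s j).PosDef := fun j hj => posDef_hankel_of_le h1 hj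
    have hh : ∀ j ≤ n, (hankel (hatSeq a b s) j).PosDef := fun j hj => posDef_hankel_of_le h2 hj
    have hr : ∀ j ≤ n, (hankel (rightSeq b s) j).PosDef := fun j hj => posDef_hankel_of_le hk1 hj
    have hl : ∀ j ≤ n, (hankel (leftSeq a s) j).PosDef := fun j hj => posDef_hankel_of_le hk2 hj
    have hs : ∀ k < 2 * n + 1, (s k)ᴴ = s k := fun k hk =>
      conjTranspose_of_isHermitian_hankel h1.isHermitian (by omega)
    refine ⟨⟨fun j hj => ⟨ht _ (by omega), hh j hj, hr j hj, hl j hj⟩,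
      isUnit_Theta2 h1.isUnit hk2.isUnit hs, isUnit_Gamma1 hk1.isUnit h2.isUnit hs,
      isUnit_P1 (ht n (by omega)).isUnit hk2.isUnit fun k hk => hs k (by omega), fun hn => ?_⟩,
      fun hn z hza hzb => resolventEven_eq_par hab hn h1 hk2 hr hh hs hza hzb,
      fun z => resolventEven_eq_bigPar hab ht hl hk1 h2 hs z⟩
    obtain ⟨m, rfl⟩ : ∃ m, n = m + 1 := ⟨n - 1, by omega⟩
    exact isUnit_Q2 (hr _ le_rfl).isUnit (hh m (by omega)).isUnit fun k hk => hs k (by omega)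
  · rintro ⟨hk1, hk2⟩
    have h1 := posDef_H1_of_odd hab hk1 hk2
    have h2 := posDef_H2_of_odd hab hk1 hk2
    have ht : ∀ j ≤ n + 1, (hankel s j).PosDef := fun j hj => posDef_hankel_of_le h1 hj
    have hh : ∀ j ≤ n, (hankel (hatSeq a b s) j).PosDef := fun j hj => posDef_hankel_of_le h2 hj
    have hr : ∀ j ≤ n + 1, (hankel (rightSeq b s) j).PosDef :=
      fun j hj => posDef_hankel_of_le hk1 hj
    have hl : ∀ j ≤ n + 1, (hankel (leftSeq a s) j).PosDef :=
      fun j hj => posDef_hankel_of_le hk2 hj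
    have hs0 : ∀ k ≤ 2 * n, (s k)ᴴ = s k := fun k hk =>
      conjTranspose_of_isHermitian_hankel h1.isHermitian hk
    have hs : ∀ k < 2 * n + 2, (s k)ᴴ = s k := by
      intro k hk
      rcases Nat.lt_succ_iff_lt_or_eq.1 hk with hk | rfl
      · exact hs0 k (by omega)
      -- The moment s_{2n+1} does not occur in H_{1,n}; it is self-adjoint because s^{(2)}_{2n} and
      -- s_{2n} are.
      · have e := conjTranspose_of_isHermitian_hankel hk2.isHermitian (le_refl (2 * n))
        rw [leftSeq, Matrix.conjTranspose_add, Matrix.conjTranspose_neg,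
          Matrix.conjTranspose_smul, hs0 _ le_rfl, RCLike.star_def, Complex.conj_ofReal] at e
        exact add_left_cancel e
    have hs1 : ∀ k < 2 * n + 1, (s k)ᴴ = s k := fun k hk => hs k (by omega)
    exact ⟨⟨fun j hj => ⟨ht _ (by omega), hh j hj, hr _ (by omega), hl _ (by omega)⟩,
      isUnit_Q2 hk1.isUnit h2.isUnit hs, isUnit_P1 h1.isUnit hk2.isUnit hs,
      isUnit_Gamma1 (hr n (by omega)).isUnit h2.isUnit hs1,
      isUnit_Theta2 h1.isUnit (hl n (by omega)).isUnit hs1⟩,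
      fun z hz => resolventOdd_eq_par h1 hk2 hr hh hs hz,
      fun z hz => resolventOdd_eq_bigPar ht hl hk1 h2 hs hz⟩
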